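/- Formal group laws are one-dimensional and commutative. A strict isomorphism $\gamma\colon F_1\to F_2$ of formal group laws over a commutative ring $A$ is a power series $\gamma(t)\in t+t^2A[[t]]$ with $\gamma(F_2(x,y))=F_1(\gamma(x),\gamma(y))$. Let $\mathbb L$ be the Lazard ring with its universal formal group law $F_{\mathbb L}$, and let $\mathbb LB=\mathbb L[b_1,b_2,\dots]$ and $\gamma(t)=t+\sum_{i\ge1}b_it^{i+1}$. Let $S\colon\mathbb L\to\mathbb LB$ be the ring map that classifies $\gamma(F_{\mathbb L}(\gamma^{-1}(x),\gamma^{-1}(y)))$, let $\varepsilon\colon\mathbb LB\to\mathbb L$ be the $\mathbb L$-algebra map with $b_i\mapsto 0$, and let $\Delta\colon\mathbb LB\to\mathbb LB\otimes_{\mathbb L}\mathbb LB$ (where $\mathbb L$ acts on the left factor through $S$ and on the right factor through the inclusion) be the ring map with $l\mapsto l\otimes 1$ for $l\in\mathbb L$ that sends the coefficients of $\gamma$ to those of $\gamma_2(\gamma_1(t))$, where $\gamma_1,\gamma_2$ are the images of $\gamma$ under $x\mapsto x\otimes1$ and $x\mapsto1\otimes x$. An $(\mathbb L,\mathbb LB)$-comodule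 is an $\mathbb L$-module $M$ with an additive map $\psi\colon M\to M\otimes_{\mathbb L}\mathbb LB$ such that $\psi(lm)=\psi(m)S(l)$, $(\mathrm{id}\otimes\varepsilon)\psi=\mathrm{id}$ and $(\mathrm{id}\otimes\Delta)\psi=(\psi\otimes\mathrm{id})\psi$. Let $p$ be a prime. A formal group law $F$ over a $\mathbb Z_{(p)}$-algebra $A$ is $p$-typical if for every prime $q\ne p$ the formal sum $\sum^F_{0\le i<q}\zeta^i t$ vanishes in $A[\zeta][[t]]$, where $A[\zeta]=A[z]/(\Phi_q(z))$, $\Phi_q$ is the $q$-th cyclotomic polynomial and $\zeta$ is the class of $z$. Let $\mathbb L\to BP$ be the map that classifies the universal $p$-typical formal group law $F_{BP}$ over $BP$, and let $\mathbb L_{(p)}$ be the localization of $\mathbb L$ at $p$. Let $M$ be an $(\mathbb L,\mathbb LB)$-comodule. Then: 1. There is a ring map $g\colon BP\to\mathbb L_{(p)}$ such that the $p$-typical formal group law $g_*F_{BP}$ is strictly isomorphic to the formal group law that $F_{\mathbb L}$ induces over $\mathbb L_{(p)}$. 2. For every such $g$, the modules $M\otimes_{\mathbb L}\mathbb L_{(p)}$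 and $(M\otimes_{\mathbb L}BP)\otimes_{BP,g}\mathbb L_{(p)}$ are isomorphic as $\mathbb L_{(p)}$-modules, hence as $\mathbb L$-modules. 3. More generally, let $f_1,f_2\colon\mathbb L\to A$ be ring maps to a commutative ring $A$ and let $\gamma_A$ be a strict isomorphism from $(f_1)_*F_{\mathbb L}$ to $(f_2)_*F_{\mathbb L}$. Let $\varphi\colon\mathbb LB\to A$ be the ring map that restricts to $f_2$ on $\mathbb L$ and sends $b_i$ to the coefficient of $t^{i+1}$ in $\gamma_A(t)$. Then there is a unique isomorphism of $A$-modules $h\colon M\otimes_{\mathbb L,f_1}A\to M\otimes_{\mathbb L,f_2}A$ with $h(m\otimes1)=(\mathrm{id}\otimes\varphi)(\psi(m))$ for all $m\in M$. -/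

import Mathlib

open scoped TensorProduct

noncomputable section

namespace LazardBP

/-! ### Strict isomorphisms of formal group laws

`FormalGroup R` is Mathlib's type of one-dimensional formal group laws `F(X, Y)` over `R`,
`F.IsComm` says that `F` is commutative, and `F.map f` is the push-forward along `f`. -/

section FormalGroupLaws

variable {R S : Type*} [CommRing R] [CommRing S]

theorem hasSubst_pair {σ : Type*} {a b : MvPowerSeries σ R}
    (ha : PowerSeries.HasSubst a) (hb : PowerSeries.HasSubst b) :
    MvPowerSeries.HasSubst ![a, b] :=
  MvPowerSeries.hasSubst_of_constantCoeff_nilpotent fun s => by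
    fin_cases s <;> simpa

theorem map_pair {σ : Type*} (f : R →+* S) (a b : MvPowerSeries σ R) :
    (fun i => MvPowerSeries.map f (![a, b] i)) =
      ![MvPowerSeries.map f a, MvPowerSeries.map f b] := by
  ext1 i; fin_cases i <;> simp

theorem subst_pair_subst {σ τ : Type*} (G : MvPowerSeries (Fin 2) R)
    {a b : MvPowerSeries σ R} (ha : PowerSeries.HasSubst a) (hb : PowerSeries.HasSubst b)
    {c : σ → MvPowerSeries τ R} (hc : MvPowerSeries.HasSubst c) :
    MvPowerSeries.subst c (MvPowerSeries.subst ![a, b] G) =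
      MvPowerSeries.subst ![MvPowerSeries.subst c a, MvPowerSeries.subst c b] G := by
  rw [MvPowerSeries.subst_comp_subst_apply (hasSubst_pair ha hb) hc]
  congr! 2 with s
  fin_cases s <;> simp

theorem hasSubst_formalAdd (F : FormalGroup R) {σ : Type*} {a b : MvPowerSeries σ R}
    (ha : PowerSeries.HasSubst a) (hb : PowerSeries.HasSubst b) :
    PowerSeries.HasSubst (F.toPowerSeries.subst ![a, b]) :=
  MvPowerSeries.IsNilpotent_subst (hasSubst_pair ha hb)
    (F.zero_constantCoeff ▸ IsNilpotent.zero)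

theorem isComm_map (F : FormalGroup R) [hF : F.IsComm] (f : R →+* S) : (F.map f).IsComm where
  comm := by
    have h := congrArg (MvPowerSeries.map f) hF.comm
    rw [MvPowerSeries.map_subst MvPowerSeries.HasSubst.X_X, map_pair] at h
    simpa using h

/-- A strict isomorphism `γ : F₁ → F₂` of formal group laws over `R`: a series
`γ(t) = t + (terms of degree ≥ 2)` with `γ(F₂(x, y)) = F₁(γ(x), γ(y))`. -/
structure IsStrictIso (γ : PowerSeries R) (F₁ F₂ : FormalGroup R) : Prop where
  constantCoeff_eq : PowerSeries.constantCoeff γ = 0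
  coeff_one_eq : PowerSeries.coeff 1 γ = 1
  hom : γ.subst F₂.toPowerSeries =
    F₁.toPowerSeries.subst
      ![γ.subst (MvPowerSeries.X 0 : MvPowerSeries (Fin 2) R),
        γ.subst (MvPowerSeries.X 1 : MvPowerSeries (Fin 2) R)]

/-- Two formal group laws over `R` are strictly isomorphic. -/
def StrictlyIsomorphic (F₁ F₂ : FormalGroup R) : Prop :=
  ∃ γ : PowerSeries R, IsStrictIso γ F₁ F₂

theorem hasSubst_subst {σ : Type*} {γ : PowerSeries R} (h0 : PowerSeries.constantCoeff γ = 0)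
    {a : MvPowerSeries σ R} (ha : PowerSeries.HasSubst a) :
    PowerSeries.HasSubst (γ.subst a) := by
  refine MvPowerSeries.IsNilpotent_subst ha.const ?_
  have : MvPowerSeries.constantCoeff γ = 0 := h0
  rw [this]; exact IsNilpotent.zero

/-- The series `γ(F(γ⁻¹(x), γ⁻¹(y)))`. -/
def twistSeries (F : FormalGroup R) (γ : PowerSeries R) (h1 : PowerSeries.coeff 1 γ = 1) :
    MvPowerSeries (Fin 2) R :=
  γ.subst (F.toPowerSeries.subst
    ![(γ.substInvOfIsUnit (h1 ▸ isUnit_one)).subst (MvPowerSeries.X 0 : MvPowerSeries (Fin 2) R),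
      (γ.substInvOfIsUnit (h1 ▸ isUnit_one)).subst (MvPowerSeries.X 1 : MvPowerSeries (Fin 2) R)])

theorem twistSeries_subst (F : FormalGroup R) (γ : PowerSeries R)
    (h1 : PowerSeries.coeff 1 γ = 1) {σ : Type*} {a b : MvPowerSeries σ R}
    (ha : PowerSeries.HasSubst a) (hb : PowerSeries.HasSubst b) :
    (twistSeries F γ h1).subst ![a, b] =
      γ.subst (F.toPowerSeries.subst
        ![(γ.substInvOfIsUnit (h1 ▸ isUnit_one)).subst a,
          (γ.substInvOfIsUnit (h1 ▸ isUnit_one)).subst b]) := by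
  set δ := γ.substInvOfIsUnit (h1 ▸ isUnit_one) with hδ
  have hδ0 : PowerSeries.constantCoeff δ = 0 := γ.constantCoeff_substInvOfIsUnit _
  have hx (i : Fin 2) : PowerSeries.HasSubst
      (δ.subst (MvPowerSeries.X i : MvPowerSeries (Fin 2) R)) :=
    hasSubst_subst hδ0 (PowerSeries.HasSubst.X i)
  have hc := hasSubst_pair ha hb
  have key (i : Fin 2) : MvPowerSeries.subst ![a, b]
      (δ.subst (MvPowerSeries.X i : MvPowerSeries (Fin 2) R)) = δ.subst (![a, b] i) := by
    rw [PowerSeries.subst, MvPowerSeries.subst_comp_subst_apply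
      (PowerSeries.HasSubst.X i).const hc, MvPowerSeries.subst_X hc]
    rfl
  rw [twistSeries, PowerSeries.subst, MvPowerSeries.subst_comp_subst_apply
    (hasSubst_formalAdd F (hx 0) (hx 1)).const hc, subst_pair_subst _ (hx 0) (hx 1) hc,
    key, key]
  rfl

theorem substInv_subst_subst {γ : PowerSeries R} (h0 : PowerSeries.constantCoeff γ = 0)
    (h1 : IsUnit (PowerSeries.coeff 1 γ)) {σ : Type*} {a : MvPowerSeries σ R}
    (ha : PowerSeries.HasSubst a) :
    (γ.substInvOfIsUnit h1).subst (γ.subst a) = a := by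
  have hγ : PowerSeries.HasSubst γ := PowerSeries.HasSubst.of_constantCoeff_zero' h0
  rw [← PowerSeries.subst_comp_subst_apply hγ ha, γ.subst_substInvOfIsUnit_left h0,
    PowerSeries.subst_X ha]

theorem subst_substInv_subst {γ : PowerSeries R} (h0 : PowerSeries.constantCoeff γ = 0)
    (h1 : IsUnit (PowerSeries.coeff 1 γ)) {σ : Type*} {a : MvPowerSeries σ R}
    (ha : PowerSeries.HasSubst a) :
    γ.subst ((γ.substInvOfIsUnit h1).subst a) = a := by
  have hγ : PowerSeries.HasSubst (γ.substInvOfIsUnit h1) :=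
    PowerSeries.HasSubst.substInvOfIsUnit _ _
  rw [← PowerSeries.subst_comp_subst_apply hγ ha, γ.subst_substInvOfIsUnit_right h0,
    PowerSeries.subst_X ha]

theorem subst_zero_eq {σ : Type*} {δ : PowerSeries R} (h0 : PowerSeries.constantCoeff δ = 0) :
    δ.subst (0 : MvPowerSeries σ R) = 0 :=
  PowerSeries.subst_zero_of_constantCoeff_zero h0

theorem coeff_subst_X_zero (G : MvPowerSeries (Fin 2) R) :
    PowerSeries.coeff 1 (MvPowerSeries.subst ![(PowerSeries.X : PowerSeries R), 0] G) =
      MvPowerSeries.coeff (Finsupp.single 0 1) G := by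
  rw [PowerSeries.coeff, MvPowerSeries.coeff_subst
    (hasSubst_pair PowerSeries.HasSubst.X' PowerSeries.HasSubst.zero'),
    finsum_eq_single _ (Finsupp.single 0 1)]
  · simp
  · intro d hd
    by_cases hd₁ : d 1 = 0
    · have : d 0 ≠ 1 := fun h => hd (by ext i; fin_cases i <;> simp [h, hd₁])
      simp [hd₁, PowerSeries.coeff_X_pow]
      grind
    simp [hd₁]

theorem coeff_subst_zero_X (G : MvPowerSeries (Fin 2) R) :
    PowerSeries.coeff 1 (MvPowerSeries.subst ![0, (PowerSeries.X : PowerSeries R)] G) =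
      MvPowerSeries.coeff (Finsupp.single 1 1) G := by
  rw [PowerSeries.coeff, MvPowerSeries.coeff_subst
    (hasSubst_pair PowerSeries.HasSubst.zero' PowerSeries.HasSubst.X'),
    finsum_eq_single _ (Finsupp.single 1 1)]
  · simp
  · intro d hd
    by_cases hd₁ : d 0 = 0
    · have : d 1 ≠ 1 := fun h => hd (by ext i; fin_cases i <;> simp [h, hd₁])
      simp [hd₁, PowerSeries.coeff_X_pow]
      grind
    simp [hd₁]

/-- The formal group law `F` twisted by `γ(t) = t + ⋯`, that is `γ(F(γ⁻¹(x), γ⁻¹(y)))`. -/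
def twist (F : FormalGroup R) (γ : PowerSeries R) (h0 : PowerSeries.constantCoeff γ = 0)
    (h1 : PowerSeries.coeff 1 γ = 1) : FormalGroup R where
  toPowerSeries := twistSeries F γ h1
  zero_constantCoeff := by
    have hδ0 : PowerSeries.constantCoeff (γ.substInvOfIsUnit (h1 ▸ isUnit_one)) = 0 :=
      γ.constantCoeff_substInvOfIsUnit _
    refine PowerSeries.constantCoeff_subst_eq_zero ?_ _ h0
    refine MvPowerSeries.constantCoeff_subst_eq_zero
      (hasSubst_pair (hasSubst_subst hδ0 (PowerSeries.HasSubst.X 0))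
        (hasSubst_subst hδ0 (PowerSeries.HasSubst.X 1))) (fun i => ?_) F.zero_constantCoeff
    fin_cases i <;>
      exact PowerSeries.constantCoeff_subst_eq_zero (by simp) _ hδ0
  lin_coeff_X := by
    have hδ0 : PowerSeries.constantCoeff (γ.substInvOfIsUnit (h1 ▸ isUnit_one)) = 0 :=
      γ.constantCoeff_substInvOfIsUnit _
    have hX : PowerSeries.HasSubst (PowerSeries.X : PowerSeries R) := PowerSeries.HasSubst.X'
    rw [← coeff_subst_X_zero, twistSeries_subst F γ h1 hX PowerSeries.HasSubst.zero',
      subst_zero_eq hδ0, F.add_zero (hasSubst_subst hδ0 hX), subst_substInv_subst h0 _ hX]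
    simp
  lin_coeff_Y := by
    have hδ0 : PowerSeries.constantCoeff (γ.substInvOfIsUnit (h1 ▸ isUnit_one)) = 0 :=
      γ.constantCoeff_substInvOfIsUnit _
    have hX : PowerSeries.HasSubst (PowerSeries.X : PowerSeries R) := PowerSeries.HasSubst.X'
    rw [← coeff_subst_zero_X, twistSeries_subst F γ h1 PowerSeries.HasSubst.zero' hX,
      subst_zero_eq hδ0, F.zero_add (hasSubst_subst hδ0 hX), subst_substInv_subst h0 _ hX]
    simp
  assoc := by
    have hδ0 : PowerSeries.constantCoeff (γ.substInvOfIsUnit (h1 ▸ isUnit_one)) = 0 :=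
      γ.constantCoeff_substInvOfIsUnit _
    have hX (i : Fin 3) : PowerSeries.HasSubst (MvPowerSeries.X i : MvPowerSeries (Fin 3) R) :=
      PowerSeries.HasSubst.X i
    have hY (i : Fin 3) := hasSubst_subst hδ0 (hX i)
    have hF (i j : Fin 3) := hasSubst_formalAdd F (hY i) (hY j)
    rw [twistSeries_subst F γ h1 (hX 0) (hX 1), twistSeries_subst F γ h1 (hX 1) (hX 2),
      twistSeries_subst F γ h1 (hasSubst_subst h0 (hF 0 1)) (hX 2),
      twistSeries_subst F γ h1 (hX 0) (hasSubst_subst h0 (hF 1 2)),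
      substInv_subst_subst h0 _ (hF 0 1), substInv_subst_subst h0 _ (hF 1 2),
      F.assoc' (hY 0) (hY 1) (hY 2)]

theorem isComm_twist (F : FormalGroup R) [F.IsComm] (γ : PowerSeries R)
    (h0 : PowerSeries.constantCoeff γ = 0) (h1 : PowerSeries.coeff 1 γ = 1) :
    (twist F γ h0 h1).IsComm where
  comm := by
    have hδ0 : PowerSeries.constantCoeff (γ.substInvOfIsUnit (h1 ▸ isUnit_one)) = 0 :=
      γ.constantCoeff_substInvOfIsUnit _
    have hX (i : Fin 2) : PowerSeries.HasSubst (MvPowerSeries.X i : MvPowerSeries (Fin 2) R) :=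
      PowerSeries.HasSubst.X i
    have hY (i : Fin 2) := hasSubst_subst hδ0 (hX i)
    change twistSeries F γ h1 = (twistSeries F γ h1).subst _
    rw [twistSeries_subst F γ h1 (hX 1) (hX 0), F.comm' (hY 1) (hY 0)]
    rfl

/-- `γ` is a strict isomorphism from the twisted formal group law to the original one. -/
theorem isStrictIso_twist (F : FormalGroup R) (γ : PowerSeries R)
    (h0 : PowerSeries.constantCoeff γ = 0) (h1 : PowerSeries.coeff 1 γ = 1) :
    IsStrictIso γ (twist F γ h0 h1) F where
  constantCoeff_eq := h0
  coeff_one_eq := h1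
  hom := by
    have hX (i : Fin 2) : PowerSeries.HasSubst (MvPowerSeries.X i : MvPowerSeries (Fin 2) R) :=
      PowerSeries.HasSubst.X i
    change _ = (twistSeries F γ h1).subst _
    rw [twistSeries_subst F γ h1 (hasSubst_subst h0 (hX 0)) (hasSubst_subst h0 (hX 1)),
      substInv_subst_subst h0 _ (hX 0), substInv_subst_subst h0 _ (hX 1)]
    congr 1
    have : (![MvPowerSeries.X 0, MvPowerSeries.X 1] : Fin 2 → MvPowerSeries (Fin 2) R) =
        MvPowerSeries.X := by
      ext1 i; fin_cases i <;> rfl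
    rw [this, MvPowerSeries.subst_self]; rfl

end FormalGroupLaws

/-! ### The Lazard ring -/

section Lazard

/-- The exponents `(i, j)` with `i + j ≥ 2`. -/
abbrev HigherExponent : Type := {d : Fin 2 →₀ ℕ // 2 ≤ d.degree}

/-- The generic series `X + Y + ∑_{i + j ≥ 2} a_{ij} X^i Y^j`, whose coefficients `a_{ij}` are
indeterminates. -/
def genericSeries : MvPowerSeries (Fin 2) (MvPolynomial HigherExponent ℤ) := fun d =>
  if h : 2 ≤ d.degree then MvPolynomial.X ⟨d, h⟩ else if d = 0 then 0 else 1

/-- For a series `F` in two variables, the difference `F(F(x, y), z) - F(x, F(y, z))`. -/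
def associator {R : Type*} [CommRing R] (F : MvPowerSeries (Fin 2) R) :
    MvPowerSeries (Fin 3) R :=
  F.subst ![F.subst ![MvPowerSeries.X 0, MvPowerSeries.X 1], MvPowerSeries.X 2] -
    F.subst ![MvPowerSeries.X 0, F.subst ![MvPowerSeries.X 1, MvPowerSeries.X 2]]

/-- For a series `F` in two variables, the difference `F(x, y) - F(y, x)`. -/
def commutator {R : Type*} [CommRing R] (F : MvPowerSeries (Fin 2) R) :
    MvPowerSeries (Fin 2) R :=
  F - F.subst ![MvPowerSeries.X 1, MvPowerSeries.X 0]

/-- The ideal of relations between the `a_{ij}` that express associativity and commutativity. -/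
def lazardIdeal : Ideal (MvPolynomial HigherExponent ℤ) :=
  Ideal.span (Set.range (fun d => MvPowerSeries.coeff d (associator genericSeries)) ∪
    Set.range (fun d => MvPowerSeries.coeff d (commutator genericSeries)))

/-- The Lazard ring `𝕃`. -/
def Lazard : Type := MvPolynomial HigherExponent ℤ ⧸ lazardIdeal

instance : CommRing Lazard :=
  inferInstanceAs (CommRing (MvPolynomial HigherExponent ℤ ⧸ lazardIdeal))

/-- The projection from the polynomial ring in the `a_{ij}` to the Lazard ring. -/
def lazardMk : MvPolynomial HigherExponent ℤ →+* Lazard := Ideal.Quotient.mk lazardIdeal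

theorem constantCoeff_genericSeries : MvPowerSeries.constantCoeff genericSeries = 0 := by
  change genericSeries 0 = 0
  simp [genericSeries]

theorem map_associator {R S : Type*} [CommRing R] [CommRing S] (f : R →+* S)
    {F : MvPowerSeries (Fin 2) R} (hF : MvPowerSeries.constantCoeff F = 0) :
    MvPowerSeries.map f (associator F) = associator (MvPowerSeries.map f F) := by
  simp only [associator, map_sub]
  rw [MvPowerSeries.map_subst (MvPowerSeries.HasSubst.cons_subst_zero_left (0 : Fin 3) 1 2 hF),
    MvPowerSeries.map_subst (MvPowerSeries.HasSubst.cons_subst_zero_right (0 : Fin 3) 1 2 hF),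
    map_pair, map_pair, MvPowerSeries.map_subst MvPowerSeries.HasSubst.X_X,
    MvPowerSeries.map_subst MvPowerSeries.HasSubst.X_X, map_pair, map_pair]
  simp only [MvPowerSeries.map_X]

theorem map_commutator {R S : Type*} [CommRing R] [CommRing S] (f : R →+* S)
    (F : MvPowerSeries (Fin 2) R) :
    MvPowerSeries.map f (commutator F) = commutator (MvPowerSeries.map f F) := by
  simp only [commutator, map_sub]
  rw [MvPowerSeries.map_subst MvPowerSeries.HasSubst.X_X, map_pair]
  simp only [MvPowerSeries.map_X]

/-- The universal formal group law over the Lazard ring. -/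
def universalFGL : FormalGroup Lazard where
  toPowerSeries := MvPowerSeries.map lazardMk genericSeries
  zero_constantCoeff := by
    rw [MvPowerSeries.constantCoeff_map, constantCoeff_genericSeries, map_zero]
  lin_coeff_X := by
    rw [MvPowerSeries.coeff_map]
    change lazardMk (genericSeries _) = 1
    simp [genericSeries]
  lin_coeff_Y := by
    rw [MvPowerSeries.coeff_map]
    change lazardMk (genericSeries _) = 1
    simp [genericSeries]
  assoc := by
    rw [← sub_eq_zero]
    change associator _ = 0
    rw [← map_associator _ constantCoeff_genericSeries]
    ext d
    rw [MvPowerSeries.coeff_map, map_zero]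
    exact Ideal.Quotient.eq_zero_iff_mem.mpr (Ideal.subset_span (Or.inl ⟨d, rfl⟩))

instance : universalFGL.IsComm where
  comm := by
    rw [← sub_eq_zero]
    change commutator (MvPowerSeries.map lazardMk genericSeries) = 0
    rw [← map_commutator]
    ext d
    rw [MvPowerSeries.coeff_map, map_zero]
    exact Ideal.Quotient.eq_zero_iff_mem.mpr (Ideal.subset_span (Or.inr ⟨d, rfl⟩))

variable {A : Type*} [CommRing A]

/-- Specialization of the indeterminates `a_{ij}` to the coefficients of a formal group law. -/
def specialize (F : FormalGroup A) : MvPolynomial HigherExponent ℤ →+* A :=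
  MvPolynomial.eval₂Hom (Int.castRingHom A) fun d => MvPowerSeries.coeff d.1 F.toPowerSeries

theorem map_specialize (F : FormalGroup A) :
    MvPowerSeries.map (specialize F) genericSeries = F.toPowerSeries := by
  ext d
  rw [MvPowerSeries.coeff_map]
  change specialize F (genericSeries d) = _
  by_cases h2 : 2 ≤ d.degree
  · simp [genericSeries, h2, specialize]
  by_cases h0 : d = 0
  · subst h0
    simpa [genericSeries] using F.zero_constantCoeff.symm
  have h1 : d.degree = 1 := by
    have := mt (Finsupp.degree_eq_zero_iff d).mp h0
    omega
  have hs : d 0 + d 1 = 1 := by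
    have := Finsupp.degree_eq_sum d
    rw [Fin.sum_univ_two] at this
    omega
  rcases Nat.eq_zero_or_pos (d 0) with hd | hd
  · obtain rfl : d = Finsupp.single 1 1 := by
      ext i; fin_cases i <;> simp <;> omega
    simp [genericSeries, F.lin_coeff_Y]
  · obtain rfl : d = Finsupp.single 0 1 := by
      ext i; fin_cases i <;> simp <;> omega
    simp [genericSeries, F.lin_coeff_X]

/-- The ring homomorphism `𝕃 → A` that classifies a commutative formal group law over `A`. -/
def classify (F : FormalGroup A) [hF : F.IsComm] : Lazard →+* A :=
  Ideal.Quotient.lift lazardIdeal (specialize F) fun a ha => by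
    have hle : lazardIdeal ≤ RingHom.ker (specialize F) := by
      refine Ideal.span_le.mpr ?_
      rintro _ (⟨d, rfl⟩ | ⟨d, rfl⟩)
      · change specialize F _ = 0
        rw [← MvPowerSeries.coeff_map, map_associator _ constantCoeff_genericSeries,
          map_specialize, associator, sub_eq_zero.mpr F.assoc, map_zero]
      · change specialize F _ = 0
        rw [← MvPowerSeries.coeff_map, map_commutator, map_specialize, commutator,
          sub_eq_zero.mpr hF.comm, map_zero]
    exact hle ha

theorem map_classify (F : FormalGroup A) [F.IsComm] : universalFGL.map (classify F) = F := by
  ext1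
  have h : (classify F).comp lazardMk = specialize F := Ideal.Quotient.lift_comp_mk _ _ _
  change MvPowerSeries.map (classify F) (MvPowerSeries.map lazardMk genericSeries) = _
  rw [← map_specialize F, ← h, MvPowerSeries.map_comp]
  rfl

theorem lazard_hom_ext {f g : Lazard →+* A} (h : universalFGL.map f = universalFGL.map g) :
    f = g := by
  refine Ideal.Quotient.ringHom_ext (MvPolynomial.ringHom_ext (fun n => by simp) fun d => ?_)
  have h' := congrArg (fun F : FormalGroup A => MvPowerSeries.coeff d.1 F.toPowerSeries) h
  have hd : MvPowerSeries.coeff d.1 genericSeries = MvPolynomial.X d := by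
    change genericSeries d.1 = _
    simp [genericSeries, d.2]
  simp only [FormalGroup.map_toPowerSeries, universalFGL, MvPowerSeries.coeff_map, hd] at h'
  exact h'

end Lazard

/-! ### Restriction of scalars along a ring homomorphism -/

section Via

variable {R A : Type*} [CommRing R] [CommRing A]

/-- The ring `A` regarded as an `R`-algebra through `f : R →+* A`. For an `R`-module `M`,
`Via f ⊗[R] M` is the `A`-module `M ⊗_{R, f} A`. -/
def Via (_f : R →+* A) : Type _ := A

variable (f : R →+* A)

instance : CommRing (Via f) := inferInstanceAs (CommRing A)

instance : Algebra R (Via f) := f.toAlgebra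

instance : Algebra A (Via f) := Algebra.id A

instance : SMulCommClass R A (Via f) where
  smul_comm r a x := mul_left_comm (f r : A) a (x : A)

/-- The identity map from `A` to `A` regarded as an `R`-algebra through `f`. -/
def Via.of : A →+* Via f := RingHom.id A

end Via

/-! ### The Hopf algebroid `(𝕃, 𝕃B)` and its comodules -/

section HopfAlgebroid

/-- The ring `𝕃B = 𝕃[b₁, b₂, …]`; the variable `MvPolynomial.X n` is `b_{n+1}`. Its structure of
an `𝕃`-algebra is the left unit. -/
abbrev LB : Type := MvPolynomial ℕ Lazard

/-- The series `γ(t) = t + ∑_{i ≥ 1} b_i t^{i+1}` over `𝕃B`. -/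
def gammaLN : PowerSeries LB :=
  PowerSeries.mk fun
    | 0 => 0
    | 1 => 1
    | n + 2 => MvPolynomial.X n

theorem constantCoeff_gammaLN : PowerSeries.constantCoeff gammaLN = 0 := by
  rw [← PowerSeries.coeff_zero_eq_constantCoeff_apply, gammaLN, PowerSeries.coeff_mk]

theorem coeff_one_gammaLN : PowerSeries.coeff 1 gammaLN = 1 := by
  rw [gammaLN, PowerSeries.coeff_mk]

/-- The universal formal group law, extended to `𝕃B` and twisted by `γ`. -/
def twistedFGL : FormalGroup LB :=
  twist (universalFGL.map (algebraMap Lazard LB)) gammaLN constantCoeff_gammaLN coeff_one_gammaLN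

instance : twistedFGL.IsComm :=
  haveI := isComm_map universalFGL (algebraMap Lazard LB)
  isComm_twist _ _ _ _

/-- The right unit `S : 𝕃 → 𝕃B`, which classifies the twisted universal formal group law. -/
def rightUnit : Lazard →+* LB := classify twistedFGL

/-- The counit `ε : 𝕃B → 𝕃`, `b_i ↦ 0`. -/
def counit : LB →ₐ[Lazard] Lazard := MvPolynomial.aeval fun _ => 0

/-- The ring `𝕃B ⊗_𝕃 𝕃B`, where `𝕃` acts on the first factor through the right unit and on the
second factor through the left unit. -/
def LB2 : Type := Via rightUnit ⊗[Lazard] LB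

instance : CommRing LB2 := inferInstanceAs (CommRing (Via rightUnit ⊗[Lazard] LB))

/-- `x ↦ x ⊗ 1`. -/
def inl : LB →+* LB2 :=
  (Algebra.TensorProduct.includeLeftRingHom : Via rightUnit →+* Via rightUnit ⊗[Lazard] LB).comp
    (Via.of rightUnit)

/-- `x ↦ 1 ⊗ x`. -/
def inr : LB →+* LB2 :=
  (Algebra.TensorProduct.includeRight : LB →ₐ[Lazard] Via rightUnit ⊗[Lazard] LB).toRingHom

/-- The map `𝕃 → 𝕃B ⊗_𝕃 𝕃B`, `l ↦ l ⊗ 1`, given by the left unit of the first factor. -/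
def leftUnit2 : Lazard →+* LB2 := inl.comp (algebraMap Lazard LB)

/-- The map `x ↦ x ⊗ 1` as a homomorphism of algebras over `𝕃`, with respect to the left units. -/
def inlAlgHom : LB →ₐ[Lazard] Via leftUnit2 where
  __ := (Via.of leftUnit2).comp inl
  commutes' _ := rfl

/-- The comultiplication `Δ : 𝕃B → 𝕃B ⊗_𝕃 𝕃B`, which is `l ↦ l ⊗ 1` on `𝕃` and maps `γ` to
`γ₂(γ₁(t))`, where `γ₁` and `γ₂` are the images of `γ` under `x ↦ x ⊗ 1` and `x ↦ 1 ⊗ x`. -/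
def comul : LB →ₐ[Lazard] Via leftUnit2 :=
  MvPolynomial.aeval fun n => Via.of leftUnit2 <|
    PowerSeries.coeff (n + 2)
      ((PowerSeries.map inr gammaLN).subst (PowerSeries.map inl gammaLN) : PowerSeries LB2)

theorem inl_rightUnit (l : Lazard) : inl (rightUnit l) = inr (algebraMap Lazard LB l) := by
  exact ((Algebra.TensorProduct.includeRight :
    LB →ₐ[Lazard] Via rightUnit ⊗[Lazard] LB).commutes l).symm

variable {M : Type*} [AddCommGroup M] [Module Lazard M]

theorem inlAlgHom_rTensor_smul (x : LB) (y : LB ⊗[Lazard] M) :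
    inlAlgHom.toLinearMap.rTensor M (x • y) = inl x • inlAlgHom.toLinearMap.rTensor M y := by
  induction y with
  | zero => simp
  | add y z hy hz => rw [smul_add, map_add, hy, hz, map_add, smul_add]
  | tmul a m =>
    rw [TensorProduct.smul_tmul', LinearMap.rTensor_tmul, LinearMap.rTensor_tmul,
      TensorProduct.smul_tmul', smul_eq_mul]
    congr 1
    exact map_mul inlAlgHom x a

/-- For `ψ : M → M ⊗_𝕃 𝕃B`, the map `ψ ⊗ id : M ⊗_𝕃 𝕃B → M ⊗_𝕃 𝕃B ⊗_𝕃 𝕃B`, which sends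
`m ⊗ x` to `ψ(m) ⊗ x`. As everywhere, the ring is written as the left factor of a tensor
product of a ring with `M`. -/
def coactionTensorId (ψ : M →ₛₗ[rightUnit] LB ⊗[Lazard] M) :
    LB ⊗[Lazard] M →+ Via leftUnit2 ⊗[Lazard] M :=
  TensorProduct.liftAddHom
    { toFun := fun x =>
        { toFun := fun m => inr x • inlAlgHom.toLinearMap.rTensor M (ψ m)
          map_zero' := by simp
          map_add' := fun m n => by simp }
      map_zero' := by ext; simp
      map_add' := fun x y => by ext; simp [add_smul] }
    fun l x m => by
      change inr (l • x) • inlAlgHom.toLinearMap.rTensor M (ψ m) =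
        inr x • inlAlgHom.toLinearMap.rTensor M (ψ (l • m))
      rw [map_smulₛₗ ψ, inlAlgHom_rTensor_smul, inl_rightUnit, smul_smul, ← map_mul,
        Algebra.smul_def, mul_comm]

variable (M) in
/-- The structure of a right comodule over the Hopf algebroid `(𝕃, 𝕃B)` on an `𝕃`-module `M`: a
map `ψ : M → M ⊗_𝕃 𝕃B` with `ψ(l m) = ψ(m) S(l)`, where `S` is the right unit and the tensor
product is formed with the left unit, that is counital and coassociative. The tensor product
`M ⊗_𝕃 𝕃B` is written as `LB ⊗[Lazard] M`, which is a module over `LB`. -/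
structure Comodule where
  /-- The coaction `ψ`. -/
  coaction : M →ₛₗ[rightUnit] LB ⊗[Lazard] M
  /-- `(id ⊗ ε) ∘ ψ = id`. -/
  counital : ∀ m, TensorProduct.lid Lazard M (counit.toLinearMap.rTensor M (coaction m)) = m
  /-- `(id ⊗ Δ) ∘ ψ = (ψ ⊗ id) ∘ ψ`. -/
  coassociative : ∀ m, comul.toLinearMap.rTensor M (coaction m) =
    coactionTensorId coaction (coaction m)

/-- The homomorphism `φ_{f, γ} : 𝕃B → A` given by `f` on `𝕃` that sends `b_i` to the coefficient
of `t^{i+1}` in `γ`. -/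
def evalLB {A : Type*} [CommRing A] (f : Lazard →+* A) (γ : PowerSeries A) :
    LB →ₐ[Lazard] Via f :=
  MvPolynomial.aeval fun n => Via.of f (PowerSeries.coeff (n + 2) γ)

end HopfAlgebroid

/-! ### `p`-typical formal group laws -/

section PTypical

variable {R S : Type*} [CommRing R] [CommRing S]

/-- The sum `a₁ +_F (a₂ +_F (⋯ +_F a_n))` of a list of power series. -/
def formalSum (F : FormalGroup R) (l : List (PowerSeries R)) : PowerSeries R :=
  l.foldr (fun a b => F.toPowerSeries.subst ![a, b]) 0

/-- The series `∑^F_{i < q} ζ^i t` over `R[ζ] = R[z]/(Φ_q(z))`, where `Φ_q` is the `q`-th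
cyclotomic polynomial. -/
def rootSum (F : FormalGroup R) (q : ℕ) :
    PowerSeries (AdjoinRoot (Polynomial.cyclotomic q R)) :=
  formalSum (F.map (AdjoinRoot.of (Polynomial.cyclotomic q R)))
    ((List.range q).map fun i =>
      PowerSeries.C (AdjoinRoot.root (Polynomial.cyclotomic q R) ^ i) * PowerSeries.X)

/-- A formal group law `F` over a `ℤ_(p)`-algebra is `p`-typical if `∑^F_{i < q} ζ^i t = 0` for
every prime `q ≠ p`, where `ζ` is a primitive `q`-th root of unity. Over a torsion-free
`ℤ_(p)`-algebra this says that the logarithm of `F` has the form `∑ l_i t^{p^i}`. -/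
def IsPTypical (p : ℕ) (F : FormalGroup R) : Prop :=
  ∀ q : ℕ, q.Prime → q ≠ p → rootSum F q = 0

/-- The ideal generated by the coordinates, in the `R`-basis `1, ζ, …, ζ^{q-2}` of `R[ζ]`, of the
coefficients of the series `∑^F_{i < q} ζ^i t`, for all primes `q ≠ p`. -/
def pTypicalIdeal (p : ℕ) (F : FormalGroup R) : Ideal R :=
  Ideal.span {a | ∃ q : ℕ, q.Prime ∧ q ≠ p ∧ ∃ n k : ℕ,
    a = (AdjoinRoot.modByMonicHom (Polynomial.cyclotomic.monic q R)
      (PowerSeries.coeff n (rootSum F q))).coeff k}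

theorem hasSubst_formalSum (F : FormalGroup R) {l : List (PowerSeries R)}
    (hl : ∀ a ∈ l, PowerSeries.HasSubst a) : PowerSeries.HasSubst (formalSum F l) := by
  induction l with
  | nil => exact PowerSeries.HasSubst.zero'
  | cons a l ih =>
    exact hasSubst_formalAdd F (hl a (by simp)) (ih fun b hb => hl b (by simp [hb]))

theorem map_formalSum (F : FormalGroup R) (φ : R →+* S) {l : List (PowerSeries R)}
    (hl : ∀ a ∈ l, PowerSeries.HasSubst a) :
    PowerSeries.map φ (formalSum F l) = formalSum (F.map φ) (l.map (PowerSeries.map φ)) := by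
  induction l with
  | nil => simp [formalSum]
  | cons a l ih =>
    have hl' : ∀ b ∈ l, PowerSeries.HasSubst b := fun b hb => hl b (by simp [hb])
    have h := MvPowerSeries.map_subst (h := φ)
      (hasSubst_pair (hl a (by simp)) (hasSubst_formalSum F hl')) F.toPowerSeries
    rw [map_pair] at h
    have ih' := ih hl'
    change MvPowerSeries.map φ (formalSum F l) = _ at ih'
    rw [ih'] at h
    exact h

/-- The map `R[ζ] → S[ζ]` induced by `φ : R → S`. -/
def cyclotomicMap (φ : R →+* S) (q : ℕ) :
    AdjoinRoot (Polynomial.cyclotomic q R) →+* AdjoinRoot (Polynomial.cyclotomic q S) :=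
  AdjoinRoot.map φ _ _ (by rw [Polynomial.map_cyclotomic])

theorem rootSum_map (F : FormalGroup R) (φ : R →+* S) (q : ℕ) :
    rootSum (F.map φ) q = PowerSeries.map (cyclotomicMap φ q) (rootSum F q) := by
  rw [rootSum, rootSum, map_formalSum]
  · congr 1
    · ext d
      simp [cyclotomicMap]
    · simp [cyclotomicMap, Function.comp_def]
  · intro a ha
    obtain ⟨i, -, rfl⟩ := List.mem_map.mp ha
    exact PowerSeries.HasSubst.of_constantCoeff_zero' (by simp)

theorem modByMonicHom_cyclotomicMap (φ : R →+* S) (q : ℕ)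
    (x : AdjoinRoot (Polynomial.cyclotomic q R)) :
    AdjoinRoot.modByMonicHom (Polynomial.cyclotomic.monic q S) (cyclotomicMap φ q x) =
      (AdjoinRoot.modByMonicHom (Polynomial.cyclotomic.monic q R) x).map φ := by
  induction x using AdjoinRoot.induction_on with
  | ih f =>
    have : cyclotomicMap φ q (AdjoinRoot.mk _ f) = AdjoinRoot.mk _ (f.map φ) := by
      rw [cyclotomicMap, AdjoinRoot.map, AdjoinRoot.lift_mk, ← Polynomial.eval₂_map,
        ← AdjoinRoot.aeval_eq, Polynomial.aeval_def, AdjoinRoot.algebraMap_eq]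
    rw [this, AdjoinRoot.modByMonicHom_mk, AdjoinRoot.modByMonicHom_mk,
      Polynomial.map_modByMonic _ (Polynomial.cyclotomic.monic q R), Polynomial.map_cyclotomic]

/-- The push-forward of `F` along `φ` is `p`-typical exactly if `φ` kills `pTypicalIdeal p F`. -/
theorem isPTypical_map_iff (p : ℕ) (F : FormalGroup R) (φ : R →+* S) :
    IsPTypical p (F.map φ) ↔ pTypicalIdeal p F ≤ RingHom.ker φ := by
  have key (q n : ℕ) : AdjoinRoot.modByMonicHom (Polynomial.cyclotomic.monic q S)
      (PowerSeries.coeff n (rootSum (F.map φ) q)) =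
      (AdjoinRoot.modByMonicHom (Polynomial.cyclotomic.monic q R)
        (PowerSeries.coeff n (rootSum F q))).map φ := by
    rw [rootSum_map, PowerSeries.coeff_map, modByMonicHom_cyclotomicMap]
  constructor
  · intro h
    refine Ideal.span_le.mpr ?_
    rintro _ ⟨q, hq, hqp, n, k, rfl⟩
    change φ _ = 0
    rw [← Polynomial.coeff_map, ← key, h q hq hqp]
    simp
  · intro h q hq hqp
    ext n
    apply (AdjoinRoot.mk_leftInverse (Polynomial.cyclotomic.monic q S)).injective
    rw [key, map_zero, map_zero]
    ext k
    rw [Polynomial.coeff_map, Polynomial.coeff_zero]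
    exact h (Ideal.subset_span ⟨q, hq, hqp, n, k, rfl⟩)

end PTypical

/-! ### The rings `𝕃_(p)` and `BP` -/

section BrownPeterson

variable (p : ℕ) [hp : Fact p.Prime]

/-- The multiplicative set of integers that are not divisible by `p`. -/
def primeTo : Submonoid ℤ where
  carrier := {n | ¬ (p : ℤ) ∣ n}
  one_mem' h := (Nat.prime_iff_prime_int.mp hp.out).not_isUnit (isUnit_of_dvd_one h)
  mul_mem' ha hb h := ((Nat.prime_iff_prime_int.mp hp.out).dvd_or_dvd h).elim ha hb

/-- The localization `𝕃_(p)` of the Lazard ring at `p`. -/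
abbrev LazardLoc : Type := Localization ((primeTo p).map (Int.castRingHom Lazard))

/-- The universal formal group law, regarded over `𝕃_(p)`. -/
def universalLoc : FormalGroup (LazardLoc p) :=
  universalFGL.map (algebraMap Lazard (LazardLoc p))

/-- The ring `BP` over which the universal `p`-typical formal group law is defined: the quotient
of `𝕃_(p)` by the relations that make the universal formal group law `p`-typical. -/
abbrev BP : Type := LazardLoc p ⧸ pTypicalIdeal p (universalLoc p)

/-- The universal `p`-typical formal group law; the map `𝕃 → BP` is the one that classifies it. -/
def universalPTypical : FormalGroup (BP p) := universalFGL.map (algebraMap Lazard (BP p))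

theorem universalPTypical_eq : universalPTypical p =
    (universalLoc p).map (Ideal.Quotient.mk (pTypicalIdeal p (universalLoc p))) := by
  ext d
  simp only [universalPTypical, universalLoc, FormalGroup.map_toPowerSeries,
    MvPowerSeries.coeff_map]
  rfl

theorem isPTypical_universalPTypical : IsPTypical p (universalPTypical p) := by
  rw [universalPTypical_eq, isPTypical_map_iff, Ideal.mk_ker]

/-- The universal property of `BP` among the rings in which every integer prime to `p` is
invertible. -/
theorem existsUnique_universalPTypical {A : Type*} [CommRing A]
    (hA : ∀ n : ℤ, ¬ (p : ℤ) ∣ n → IsUnit (n : A)) (F : FormalGroup A) [F.IsComm]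
    (hF : IsPTypical p F) : ∃! h : BP p →+* A, (universalPTypical p).map h = F := by
  have hu : ∀ y : (primeTo p).map (Int.castRingHom Lazard), IsUnit (classify F y) := by
    rintro ⟨_, n, hn, rfl⟩
    simpa using hA n hn
  let e : LazardLoc p →+* A := IsLocalization.lift hu
  have he : e.comp (algebraMap Lazard (LazardLoc p)) = classify F := IsLocalization.lift_comp hu
  have hmap : (universalLoc p).map e = F := by
    conv_rhs => rw [← map_classify F, ← he]
    ext d
    simp [universalLoc]
  have hker : pTypicalIdeal p (universalLoc p) ≤ RingHom.ker e := by
    rw [← isPTypical_map_iff, hmap]; exact hF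
  refine ⟨Ideal.Quotient.lift _ e fun a ha => RingHom.mem_ker.mp (hker ha), ?_, ?_⟩
  · dsimp only
    conv_rhs => rw [← hmap]
    rw [universalPTypical_eq]
    ext d
    simp
  · intro h hh
    refine Ideal.Quotient.ringHom_ext (IsLocalization.ringHom_ext
      ((primeTo p).map (Int.castRingHom Lazard)) (lazard_hom_ext ?_))
    rw [Ideal.Quotient.lift_comp_mk, he, map_classify]
    conv_rhs => rw [← hh]
    ext d
    simp only [universalPTypical, FormalGroup.map_toPowerSeries, MvPowerSeries.coeff_map]
    rfl

end BrownPeterson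

end LazardBP

end

open LazardBP

/-!
A strict isomorphism `γ` from `(f₁)_* F` to `(f₂)_* F`, with `F` universal, amounts to a map
`φ : 𝕃B → A` with `φ ∘ S = f₁` and `φ = f₂` on `𝕃`, and `(id ⊗ φ) ∘ ψ` extends to an `A`-linear
comparison map. Coassociativity of `ψ` makes these maps compatible with the composition of strict
isomorphisms and counitality gives the identity for `γ = t`, so that every comparison map is
invertible, with inverse the comparison map of `γ⁻¹`. The second claim is the case `A = 𝕃_(p)`.

For the first claim, a strict isomorphism from `F` to a `p`-typical law is a curve
`γ = t + ⋯` on `F` with `∑^F_{i < q} γ(ζ^i t) = 0` for all primes `q ≠ p`. It is built by correcting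
the curve `t` in one degree `n` at a time. Say that these sums vanish below degree `n`. The
substitution `t ↦ ζ t` fixes them, which kills the coefficient of `t ^ n` unless `q ∣ n`. For
primes `q` and `r` that divide `n`, the two summation operators commute, hence `r` times the
coefficient for `q` is `q` times the one for `r`: a single correction `a t ^ n` takes care of all
primes at once.
-/

noncomputable section

namespace LazardBP

open PowerSeries (HasSubst X C coeff constantCoeff rescale)
open scoped PowerSeries

section StrictIso

variable {R S T : Type*} [CommRing R] [CommRing S] [CommRing T]

theorem formalGroup_map_map (F : FormalGroup R) (f : R →+* S) (g : S →+* T) :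
    (F.map f).map g = F.map (g.comp f) := by
  ext d
  simp

instance (F : FormalGroup R) [F.IsComm] (f : R →+* S) : (F.map f).IsComm :=
  isComm_map F f

theorem hasSubst_toPowerSeries (F : FormalGroup R) : HasSubst F.toPowerSeries :=
  HasSubst.of_constantCoeff_zero F.zero_constantCoeff

theorem hasSubst_map {σ : Type*} (f : R →+* S) {a : MvPowerSeries σ R} (ha : HasSubst a) :
    HasSubst (MvPowerSeries.map f a) := by
  rw [HasSubst, MvPowerSeries.constantCoeff_map]
  exact ha.map f

theorem subst_X_X (G : MvPowerSeries (Fin 2) R) :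
    G.subst ![(MvPowerSeries.X 0 : MvPowerSeries (Fin 2) R), MvPowerSeries.X 1] = G := by
  have h : ![MvPowerSeries.X 0, MvPowerSeries.X 1] =
      (MvPowerSeries.X : Fin 2 → MvPowerSeries (Fin 2) R) := by
    ext1 i; fin_cases i <;> rfl
  rw [h, MvPowerSeries.subst_self, id]

theorem mvSubst_subst {σ τ : Type*} (γ : R⟦X⟧) {a : MvPowerSeries σ R} (ha : HasSubst a)
    {c : σ → MvPowerSeries τ R} (hc : MvPowerSeries.HasSubst c) :
    MvPowerSeries.subst c (γ.subst a) = γ.subst (MvPowerSeries.subst c a) :=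
  MvPowerSeries.subst_comp_subst_apply ha.const hc γ

theorem coeff_one_subst {δ : R⟦X⟧} (hδ : constantCoeff δ = 0) (γ : R⟦X⟧) :
    coeff 1 (γ.subst δ : R⟦X⟧) = coeff 1 γ * coeff 1 δ := by
  rw [PowerSeries.coeff_subst' (HasSubst.of_constantCoeff_zero' hδ), finsum_eq_single _ 1]
  · rw [pow_one, smul_eq_mul]
  · rintro (_ | _ | d) hd
    · rw [pow_zero, PowerSeries.coeff_one, if_neg one_ne_zero, smul_zero]
    · exact absurd rfl hd
    · have h : X ^ 2 ∣ δ ^ (d + 2) :=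
        (pow_dvd_pow_of_dvd (PowerSeries.X_dvd_iff.mpr hδ) 2).trans (pow_dvd_pow δ (by omega))
      rw [PowerSeries.X_pow_dvd_iff.mp h 1 one_lt_two, smul_zero]

theorem substInvOfIsUnit_eq_of_subst_eq_X {γ δ : R⟦X⟧} (hγ₀ : constantCoeff γ = 0)
    (hγ₁ : IsUnit (coeff 1 γ)) (hδ : HasSubst δ) (h : (γ.subst δ : R⟦X⟧) = X) :
    γ.substInvOfIsUnit hγ₁ = δ := by
  have key := substInv_subst_subst hγ₀ hγ₁ hδ
  rw [h] at key
  exact (PowerSeries.X_subst _).symm.trans key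

theorem coeff_one_substInvOfIsUnit_eq_one {γ : R⟦X⟧} (hγ : IsUnit (coeff 1 γ))
    (h : coeff 1 γ = 1) : coeff 1 (γ.substInvOfIsUnit hγ) = 1 := by
  rw [γ.coeff_one_substInvOfIsUnit, inv_eq_one.mpr (Units.ext h), Units.val_one]

namespace IsStrictIso

variable {γ δ : R⟦X⟧} {F₁ F₂ F₃ : FormalGroup R}

theorem isUnit_coeff_one (h : IsStrictIso γ F₁ F₂) : IsUnit (coeff 1 γ) :=
  h.coeff_one_eq ▸ isUnit_one

theorem hasSubst (h : IsStrictIso γ F₁ F₂) : HasSubst γ :=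
  HasSubst.of_constantCoeff_zero' h.constantCoeff_eq

theorem subst_formalAdd (h : IsStrictIso γ F₁ F₂) {σ : Type*} {a b : MvPowerSeries σ R}
    (ha : HasSubst a) (hb : HasSubst b) :
    γ.subst (F₂.toPowerSeries.subst ![a, b]) =
      F₁.toPowerSeries.subst ![γ.subst a, γ.subst b] := by
  have hab := hasSubst_pair ha hb
  rw [← mvSubst_subst γ (hasSubst_toPowerSeries F₂) hab, h.hom,
    subst_pair_subst _ (hasSubst_subst h.constantCoeff_eq (.X 0))
      (hasSubst_subst h.constantCoeff_eq (.X 1)) hab,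
    mvSubst_subst γ (.X 0) hab, mvSubst_subst γ (.X 1) hab, MvPowerSeries.subst_X hab,
    MvPowerSeries.subst_X hab]
  rfl

theorem trans (h : IsStrictIso γ F₁ F₂) (h' : IsStrictIso δ F₂ F₃) :
    IsStrictIso (γ.subst δ : R⟦X⟧) F₁ F₃ where
  constantCoeff_eq :=
    PowerSeries.constantCoeff_subst_eq_zero h'.constantCoeff_eq γ h.constantCoeff_eq
  coeff_one_eq := by
    rw [coeff_one_subst h'.constantCoeff_eq, h.coeff_one_eq, h'.coeff_one_eq, one_mul]
  hom := by
    rw [PowerSeries.subst_comp_subst_apply h'.hasSubst (hasSubst_toPowerSeries F₃),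
      PowerSeries.subst_comp_subst_apply h'.hasSubst (.X 0),
      PowerSeries.subst_comp_subst_apply h'.hasSubst (.X 1), h'.hom,
      h.subst_formalAdd (hasSubst_subst h'.constantCoeff_eq (.X 0))
        (hasSubst_subst h'.constantCoeff_eq (.X 1))]

theorem symm (h : IsStrictIso γ F₁ F₂) :
    IsStrictIso (γ.substInvOfIsUnit h.isUnit_coeff_one) F₂ F₁ where
  constantCoeff_eq := γ.constantCoeff_substInvOfIsUnit _
  coeff_one_eq := coeff_one_substInvOfIsUnit_eq_one _ h.coeff_one_eq
  hom := by
    have hX (i : Fin 2) : HasSubst (MvPowerSeries.X i : MvPowerSeries (Fin 2) R) := .X i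
    have hY (i : Fin 2) :=
      hasSubst_subst (γ.constantCoeff_substInvOfIsUnit h.isUnit_coeff_one) (hX i)
    have key := h.subst_formalAdd (hY 0) (hY 1)
    rw [subst_substInv_subst h.constantCoeff_eq _ (hX 0),
      subst_substInv_subst h.constantCoeff_eq _ (hX 1), subst_X_X] at key
    rw [← key, substInv_subst_subst h.constantCoeff_eq _ (hasSubst_formalAdd F₂ (hY 0) (hY 1))]

theorem eq_of_X (h : IsStrictIso X F₁ F₂) : F₁ = F₂ := by
  have key := h.hom
  rw [PowerSeries.subst_X (hasSubst_toPowerSeries F₂), PowerSeries.subst_X (.X 0),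
    PowerSeries.subst_X (.X 1), subst_X_X] at key
  exact FormalGroup.ext key.symm

theorem left_unique {F₁' : FormalGroup R} (h : IsStrictIso γ F₁ F₂) (h' : IsStrictIso γ F₁' F₂) :
    F₁ = F₁' := by
  have key := h.trans h'.symm
  rw [γ.subst_substInvOfIsUnit_right h.constantCoeff_eq] at key
  exact key.eq_of_X

theorem map (h : IsStrictIso γ F₁ F₂) (f : R →+* S) :
    IsStrictIso (PowerSeries.map f γ) (F₁.map f) (F₂.map f) where
  constantCoeff_eq := by
    rw [← PowerSeries.coeff_zero_eq_constantCoeff_apply, PowerSeries.coeff_map,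
      PowerSeries.coeff_zero_eq_constantCoeff_apply, h.constantCoeff_eq, map_zero]
  coeff_one_eq := by rw [PowerSeries.coeff_map, h.coeff_one_eq, map_one]
  hom := by
    have key := congrArg (MvPowerSeries.map f) h.hom
    rw [MvPowerSeries.map_subst (hasSubst_pair (hasSubst_subst h.constantCoeff_eq (.X 0))
      (hasSubst_subst h.constantCoeff_eq (.X 1))), map_pair,
      PowerSeries.map_subst (hasSubst_toPowerSeries F₂), PowerSeries.map_subst (.X 0),
      PowerSeries.map_subst (.X 1), MvPowerSeries.map_X, MvPowerSeries.map_X] at key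
    exact key

end IsStrictIso

theorem exists_isComm_isStrictIso (F : FormalGroup R) [F.IsComm] {γ : R⟦X⟧}
    (hγ₀ : constantCoeff γ = 0) (hγ₁ : coeff 1 γ = 1) :
    ∃ F' : FormalGroup R, F'.IsComm ∧ IsStrictIso γ F F' := by
  have hu : IsUnit (coeff 1 γ) := hγ₁ ▸ isUnit_one
  have hδ₀ := γ.constantCoeff_substInvOfIsUnit hu
  have hδ₁ := coeff_one_substInvOfIsUnit_eq_one hu hγ₁
  have h := (isStrictIso_twist F _ hδ₀ hδ₁).symm
  rw [substInvOfIsUnit_eq_of_subst_eq_X hδ₀ _ (HasSubst.of_constantCoeff_zero' hγ₀)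
    (γ.subst_substInvOfIsUnit_left hγ₀ hu)] at h
  exact ⟨_, isComm_twist F _ hδ₀ hδ₁, h⟩

end StrictIso

section BaseChange

variable {R A : Type*} [CommRing R] [CommRing A] {M N : Type*} [AddCommGroup M] [Module R M]
  [AddCommGroup N] [Module A N]

theorem rTensor_algHom_smul {B B' : Type*} [CommRing B] [CommRing B'] [Algebra R B]
    [Algebra R B'] (φ : B →ₐ[R] B') (b : B) (y : B ⊗[R] M) :
    φ.toLinearMap.rTensor M (b • y) = φ b • φ.toLinearMap.rTensor M y := by
  induction y with
  | zero => rw [smul_zero, map_zero, smul_zero]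
  | add y z hy hz => rw [smul_add, map_add, hy, hz, map_add, smul_add]
  | tmul c m =>
    rw [TensorProduct.smul_tmul', LinearMap.rTensor_tmul, LinearMap.rTensor_tmul,
      TensorProduct.smul_tmul', smul_eq_mul, smul_eq_mul, AlgHom.toLinearMap_apply,
      AlgHom.toLinearMap_apply, map_mul]

namespace Via

variable {f : R →+* A}

/-- The additive map underlying `Via.lift`. -/
def liftAddHom (u : M →ₛₗ[f] N) : Via f ⊗[R] M →+ N :=
  TensorProduct.liftAddHom ((AddMonoidHom.compHom' u.toAddMonoidHom).comp (smulAddHom A N))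
    fun r a m => by
      change (f r * (show A from a)) • u m = (show A from a) • u (r • m)
      rw [map_smulₛₗ, smul_smul, mul_comm]

/-- The extension `a ⊗ m ↦ a • u m` of an `f`-semilinear map `u` to the base change along `f`. -/
def lift (u : M →ₛₗ[f] N) : Via f ⊗[R] M →ₗ[A] N where
  toFun := liftAddHom u
  map_add' := map_add _
  map_smul' a y := by
    induction y with
    | zero => rw [smul_zero, map_zero, smul_zero]
    | add y z hy hz => rw [smul_add, map_add, map_add, hy, hz, smul_add]
    | tmul b m => exact mul_smul a (show A from b) (u m)

theorem lift_one_tmul (u : M →ₛₗ[f] N) (m : M) : lift u (1 ⊗ₜ[R] m) = u m :=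
  one_smul A (u m)

theorem hom_ext {u v : Via f ⊗[R] M →ₗ[A] N} (h : ∀ m, u (1 ⊗ₜ[R] m) = v (1 ⊗ₜ[R] m)) :
    u = v := by
  ext y
  induction y with
  | zero => rw [map_zero, map_zero]
  | add y z hy hz => rw [map_add, map_add, hy, hz]
  | tmul a m =>
    have ha : a ⊗ₜ[R] m = (show A from a) • ((1 : Via f) ⊗ₜ[R] m) :=
      congrArg (· ⊗ₜ[R] m) (mul_one (show A from a)).symm
    rw [ha, map_smul, map_smul, h]

/-- Base change along the structure map of an `R`-algebra. -/
def algebraMapEquiv [Algebra R A] : (A ⊗[R] M) ≃ₗ[A] (Via (algebraMap R A) ⊗[R] M) :=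
  haveI : IsScalarTower R A (Via (algebraMap R A)) :=
    ⟨fun r a x => by
      change (r • a) * (show A from x) = algebraMap R A r * (a * (show A from x))
      rw [Algebra.smul_def, mul_assoc]⟩
  TensorProduct.AlgebraTensorModule.congr
    (show A ≃ₗ[A] Via (algebraMap R A) from LinearEquiv.refl A A) (LinearEquiv.refl R M)

/-- Transitivity of base change. -/
def cancelBaseChange {B : Type*} [CommRing B] [Algebra R B] (g : B →+* A) :
    (Via g ⊗[B] (B ⊗[R] M)) ≃ₗ[A] (Via (g.comp (algebraMap R B)) ⊗[R] M) :=
  letI : Algebra R (Via g) := (g.comp (algebraMap R B)).toAlgebra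
  haveI : IsScalarTower R B (Via g) := IsScalarTower.of_algebraMap_eq fun _ => rfl
  letI : Algebra B A := g.toAlgebra
  letI : Algebra R A := (g.comp (algebraMap R B)).toAlgebra
  haveI : IsScalarTower B A (Via g) := ⟨fun b a x => mul_assoc (g b) a (show A from x)⟩
  haveI : IsScalarTower R A (Via g) :=
    ⟨fun r a x => mul_assoc (g (algebraMap R B r)) a (show A from x)⟩
  TensorProduct.AlgebraTensorModule.cancelBaseChange R B A (Via g) M

end Via

end BaseChange

section Comparison

variable {A : Type*} [CommRing A] {M : Type*} [AddCommGroup M] [Module Lazard M]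

/-- The homomorphism `evalLB f γ` with values in `A` itself, without its `𝕃`-algebra structure. -/
def evalRingHom (f : Lazard →+* A) (γ : A⟦X⟧) : LB →+* A :=
  (evalLB f γ : LB →+* Via f)

theorem evalRingHom_comp_algebraMap (f : Lazard →+* A) (γ : A⟦X⟧) :
    (evalRingHom f γ).comp (algebraMap Lazard LB) = f :=
  RingHom.ext (evalLB f γ).commutes

theorem evalLB_X (f : Lazard →+* A) (γ : A⟦X⟧) (n : ℕ) :
    evalLB f γ (MvPolynomial.X n) = Via.of f (coeff (n + 2) γ) :=
  MvPolynomial.aeval_X _ n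

theorem map_evalRingHom_gammaLN (f : Lazard →+* A) {γ : A⟦X⟧} (hγ₀ : constantCoeff γ = 0)
    (hγ₁ : coeff 1 γ = 1) : PowerSeries.map (evalRingHom f γ) gammaLN = γ := by
  ext n
  rw [PowerSeries.coeff_map, gammaLN, PowerSeries.coeff_mk]
  rcases n with _ | _ | n
  · rw [map_zero, PowerSeries.coeff_zero_eq_constantCoeff_apply, hγ₀]
  · rw [map_one, hγ₁]
  · exact evalLB_X f γ n

variable {f f₁ f₂ f₃ : Lazard →+* A} {γ δ : A⟦X⟧}

theorem evalRingHom_comp_rightUnit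
    (h : IsStrictIso γ (universalFGL.map f₁) (universalFGL.map f₂)) :
    (evalRingHom f₂ γ).comp rightUnit = f₁ := by
  refine lazard_hom_ext ?_
  have h' := (isStrictIso_twist (universalFGL.map (algebraMap Lazard LB)) gammaLN
    constantCoeff_gammaLN coeff_one_gammaLN).map (evalRingHom f₂ γ)
  rw [map_evalRingHom_gammaLN f₂ h.constantCoeff_eq h.coeff_one_eq, formalGroup_map_map,
    evalRingHom_comp_algebraMap] at h'
  rw [← formalGroup_map_map, rightUnit, map_classify]
  exact h'.left_unique h

/-- The coaction followed by the base change along the map `𝕃B → A` that corresponds to a strict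
isomorphism. -/
def Comodule.evalCoaction (C : Comodule M)
    (h : IsStrictIso γ (universalFGL.map f₁) (universalFGL.map f₂)) :
    M →ₛₗ[f₁] Via f₂ ⊗[Lazard] M where
  toFun m := (evalLB f₂ γ).toLinearMap.rTensor M (C.coaction m)
  map_add' m n := by rw [map_add, map_add]
  map_smul' l m := by
    rw [map_smulₛₗ, rTensor_algHom_smul, ← evalRingHom_comp_rightUnit h]
    rfl

/-- The `A`-linear map `M ⊗_{𝕃, f₁} A → M ⊗_{𝕃, f₂} A` that a strict isomorphism induces for a
comodule `M`. -/
def comparison (C : Comodule M) (h : IsStrictIso γ (universalFGL.map f₁) (universalFGL.map f₂)) :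
    Via f₁ ⊗[Lazard] M →ₗ[A] Via f₂ ⊗[Lazard] M :=
  Via.lift (C.evalCoaction h)

theorem comparison_one_tmul (C : Comodule M)
    (h : IsStrictIso γ (universalFGL.map f₁) (universalFGL.map f₂)) (m : M) :
    comparison C h (1 ⊗ₜ[Lazard] m) = (evalLB f₂ γ).toLinearMap.rTensor M (C.coaction m) :=
  Via.lift_one_tmul _ m

section Composition

/-- The homomorphism `evalLB f₃ δ` as a homomorphism of `𝕃`-algebras with respect to the right
unit. -/
def evalRight (h : IsStrictIso δ (universalFGL.map f₂) (universalFGL.map f₃)) :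
    Via rightUnit →ₐ[Lazard] Via f₂ where
  __ := evalRingHom f₃ δ
  commutes' l := DFunLike.congr_fun (evalRingHom_comp_rightUnit h) l

variable (γ) (h : IsStrictIso δ (universalFGL.map f₂) (universalFGL.map f₃))

/-- The homomorphism `𝕃B ⊗_𝕃 𝕃B → A` given by two composable strict isomorphisms: `δ` on the
first factor and `γ` on the second one. -/
def evalLB2 : LB2 →+* A :=
  (Algebra.TensorProduct.lift (evalRight h) (evalLB f₂ γ) fun _ _ => Commute.all _ _).toRingHom

theorem evalLB2_comp_inl : (evalLB2 γ h).comp inl = evalRingHom f₃ δ :=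
  congrArg (fun u => (u.toRingHom.comp (Via.of rightUnit) : LB →+* A))
    (Algebra.TensorProduct.lift_comp_includeLeft (evalRight h) (evalLB f₂ γ)
      fun _ _ => Commute.all _ _)

theorem evalLB2_comp_inr : (evalLB2 γ h).comp inr = evalRingHom f₂ γ :=
  congrArg AlgHom.toRingHom (Algebra.TensorProduct.lift_comp_includeRight (evalRight h)
    (evalLB f₂ γ) fun _ _ => Commute.all _ _)

/-- `evalLB2` as a homomorphism of `𝕃`-algebras with respect to the left units. -/
def evalLB2AlgHom : Via leftUnit2 →ₐ[Lazard] Via f₃ where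
  __ := (Via.of f₃).comp (evalLB2 γ h)
  commutes' l := by
    change ((evalLB2 γ h).comp inl) (algebraMap Lazard LB l) = f₃ l
    rw [evalLB2_comp_inl]
    exact (evalLB f₃ δ).commutes l

theorem evalLB2AlgHom_comp_inlAlgHom : (evalLB2AlgHom γ h).comp inlAlgHom = evalLB f₃ δ :=
  AlgHom.ext fun x => DFunLike.congr_fun (evalLB2_comp_inl γ h) x

theorem evalLB2AlgHom_comp_comul (hγ₀ : constantCoeff γ = 0) (hγ₁ : coeff 1 γ = 1) :
    (evalLB2AlgHom γ h).comp comul = evalLB f₃ (γ.subst δ : A⟦X⟧) := by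
  have hinr : PowerSeries.map (evalLB2 γ h) (PowerSeries.map inr gammaLN) = γ := by
    rw [← RingHom.comp_apply, ← PowerSeries.map_comp, evalLB2_comp_inr,
      map_evalRingHom_gammaLN _ hγ₀ hγ₁]
  have hinl : PowerSeries.map (evalLB2 γ h) (PowerSeries.map inl gammaLN) = δ := by
    rw [← RingHom.comp_apply, ← PowerSeries.map_comp, evalLB2_comp_inl,
      map_evalRingHom_gammaLN _ h.constantCoeff_eq h.coeff_one_eq]
  have hsubst : HasSubst (PowerSeries.map inl gammaLN) :=
    hasSubst_map inl (HasSubst.of_constantCoeff_zero' constantCoeff_gammaLN)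
  have key : PowerSeries.map (evalLB2 γ h)
      ((PowerSeries.map inr gammaLN).subst (PowerSeries.map inl gammaLN)) = γ.subst δ :=
    (PowerSeries.map_subst hsubst _).trans (congrArg₂ (fun a b => PowerSeries.subst b a) hinr hinl)
  refine MvPolynomial.algHom_ext fun n => ?_
  rw [AlgHom.comp_apply, comul, MvPolynomial.aeval_X, evalLB_X, ← key, PowerSeries.coeff_map]
  rfl

end Composition

theorem coactionTensorId_tmul (ψ : M →ₛₗ[rightUnit] LB ⊗[Lazard] M) (x : LB) (m : M) :
    coactionTensorId ψ (x ⊗ₜ[Lazard] m) =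
      Via.of leftUnit2 (inr x) • inlAlgHom.toLinearMap.rTensor M (ψ m) :=
  rfl

theorem comparison_comp (C : Comodule M)
    (h : IsStrictIso γ (universalFGL.map f₁) (universalFGL.map f₂))
    (h' : IsStrictIso δ (universalFGL.map f₂) (universalFGL.map f₃)) :
    comparison C h' ∘ₗ comparison C h = comparison C (h.trans h') := by
  have key (y : LB ⊗[Lazard] M) :
      comparison C h' ((evalLB f₂ γ).toLinearMap.rTensor M y) =
        (evalLB2AlgHom γ h').toLinearMap.rTensor M (coactionTensorId C.coaction y) := by
    induction y with
    | zero => rw [map_zero, map_zero, map_zero, map_zero]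
    | add y z hy hz => rw [map_add, map_add, map_add, map_add, hy, hz]
    | tmul x m =>
      rw [coactionTensorId_tmul, rTensor_algHom_smul (evalLB2AlgHom γ h'),
        ← LinearMap.rTensor_comp_apply, ← AlgHom.comp_toLinearMap, evalLB2AlgHom_comp_inlAlgHom]
      exact congrArg (· • C.evalCoaction h' m)
        (DFunLike.congr_fun (evalLB2_comp_inr γ h') x).symm
  refine Via.hom_ext fun m => ?_
  rw [LinearMap.comp_apply, comparison_one_tmul, comparison_one_tmul, key, ← C.coassociative,
    ← LinearMap.rTensor_comp_apply, ← AlgHom.comp_toLinearMap,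
    evalLB2AlgHom_comp_comul γ h' h.constantCoeff_eq h.coeff_one_eq]

theorem evalLB_X_eq_ofId_comp_counit (f : Lazard →+* A) :
    evalLB f X = (Algebra.ofId Lazard (Via f)).comp counit := by
  refine MvPolynomial.algHom_ext fun n => ?_
  rw [evalLB_X, AlgHom.comp_apply, counit, MvPolynomial.aeval_X, map_zero, PowerSeries.coeff_X,
    if_neg (by omega), map_zero]

theorem rTensor_ofId (f : Lazard →+* A) (y : Lazard ⊗[Lazard] M) :
    (Algebra.ofId Lazard (Via f)).toLinearMap.rTensor M y =
      1 ⊗ₜ[Lazard] TensorProduct.lid Lazard M y := by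
  induction y with
  | zero => rw [map_zero, map_zero, TensorProduct.tmul_zero]
  | add y z hy hz => rw [map_add, hy, hz, map_add, TensorProduct.tmul_add]
  | tmul l m =>
    rw [LinearMap.rTensor_tmul, TensorProduct.lid_tmul, TensorProduct.tmul_smul,
      TensorProduct.smul_tmul', Algebra.smul_def, mul_one, AlgHom.toLinearMap_apply,
      Algebra.ofId_apply]

theorem comparison_eq_id (C : Comodule M)
    (h : IsStrictIso γ (universalFGL.map f) (universalFGL.map f)) (hγ : γ = X) :
    comparison C h = LinearMap.id := by
  subst hγ
  refine Via.hom_ext fun m => ?_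
  rw [comparison_one_tmul, evalLB_X_eq_ofId_comp_counit, AlgHom.comp_toLinearMap,
    LinearMap.rTensor_comp_apply, rTensor_ofId, C.counital, LinearMap.id_apply]

/-- The isomorphism `M ⊗_{𝕃, f₁} A ≃ M ⊗_{𝕃, f₂} A` that a strict isomorphism induces for a
comodule `M`. -/
def comparisonEquiv (C : Comodule M)
    (h : IsStrictIso γ (universalFGL.map f₁) (universalFGL.map f₂)) :
    (Via f₁ ⊗[Lazard] M) ≃ₗ[A] (Via f₂ ⊗[Lazard] M) :=
  LinearEquiv.ofLinearMap (comparison C h) (comparison C h.symm)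
    ((comparison_comp C h.symm h).trans <| comparison_eq_id C _ <|
      γ.subst_substInvOfIsUnit_left h.constantCoeff_eq _)
    ((comparison_comp C h h.symm).trans <| comparison_eq_id C _ <|
      γ.subst_substInvOfIsUnit_right h.constantCoeff_eq _)

theorem existsUnique_comparisonEquiv (C : Comodule M)
    (h : IsStrictIso γ (universalFGL.map f₁) (universalFGL.map f₂)) :
    ∃! e : (Via f₁ ⊗[Lazard] M) ≃ₗ[A] (Via f₂ ⊗[Lazard] M),
      ∀ m : M, e (1 ⊗ₜ[Lazard] m) = (evalLB f₂ γ).toLinearMap.rTensor M (C.coaction m) :=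
  ⟨comparisonEquiv C h, comparison_one_tmul C h, fun _ he =>
    LinearEquiv.toLinearMap_injective <| Via.hom_ext fun m =>
      (he m).trans (comparison_one_tmul C h m).symm⟩

theorem nonempty_baseChange_equiv_of_strictlyIsomorphic (C : Comodule M) {B : Type*} [CommRing B]
    [Algebra Lazard A] [Algebra Lazard B] (g : B →+* A)
    (h : StrictlyIsomorphic (universalFGL.map (algebraMap Lazard A))
      ((universalFGL.map (algebraMap Lazard B)).map g)) :
    Nonempty ((A ⊗[Lazard] M) ≃ₗ[A] (Via g ⊗[B] (B ⊗[Lazard] M))) := by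
  obtain ⟨γ, hγ⟩ := h
  rw [formalGroup_map_map] at hγ
  exact ⟨Via.algebraMapEquiv ≪≫ₗ comparisonEquiv C hγ ≪≫ₗ (Via.cancelBaseChange g).symm⟩

end Comparison

section Curves

variable {R S : Type*} [CommRing R] [CommRing S]

/-- The additive monoid of curves on a formal group law: its points with coordinates in the ring of
power series in one variable. -/
abbrev Curve (F : FormalGroup R) : Type _ := F.Point Unit

theorem rescale_eq_mvSubst (u : R) (x : R⟦X⟧) :
    rescale u x = MvPowerSeries.subst (fun _ : Unit => (u • X : R⟦X⟧)) x :=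
  PowerSeries.rescale_eq_subst u x

theorem X_pow_dvd_rescale (u : R) {x : R⟦X⟧} {n : ℕ} (hx : X ^ n ∣ x) : X ^ n ∣ rescale u x :=
  PowerSeries.X_pow_dvd_iff.mpr fun m hm => by
    rw [PowerSeries.coeff_rescale, PowerSeries.X_pow_dvd_iff.mp hx m hm, mul_zero]

theorem X_pow_dvd_map (f : R →+* S) {x : R⟦X⟧} {n : ℕ} (hx : X ^ n ∣ x) :
    X ^ n ∣ PowerSeries.map f x := by
  simpa only [map_pow, PowerSeries.map_X] using map_dvd (PowerSeries.map f) hx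

theorem X_pow_succ_dvd_iff {x : R⟦X⟧} {n : ℕ} : X ^ (n + 1) ∣ x ↔ X ^ n ∣ x ∧ coeff n x = 0 := by
  simp only [PowerSeries.X_pow_dvd_iff, Nat.forall_lt_succ_right]

theorem exists_forall_X_pow_dvd_sub {x : ℕ → R⟦X⟧} {k : ℕ}
    (h : ∀ n, X ^ (n + k) ∣ x (n + 1) - x n) : ∃ y : R⟦X⟧, ∀ n, X ^ (n + k) ∣ y - x n := by
  have hle {m n : ℕ} (hmn : m ≤ n) : X ^ (m + k) ∣ x n - x m := by
    induction n, hmn using Nat.le_induction with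
    | base => rw [sub_self]; exact dvd_zero _
    | succ n hmn ih =>
      rw [← sub_add_sub_cancel]
      exact dvd_add ((pow_dvd_pow X (by omega)).trans (h n)) ih
  refine ⟨PowerSeries.mk fun m => coeff m (x (m + 1)), fun n => ?_⟩
  refine PowerSeries.X_pow_dvd_iff.mpr fun m hm => ?_
  rw [map_sub, PowerSeries.coeff_mk]
  rcases le_total n (m + 1) with hnm | hmn
  · rw [← map_sub]
    exact PowerSeries.X_pow_dvd_iff.mp (hle hnm) m hm
  · rw [← neg_eq_zero, neg_sub, ← map_sub]
    exact PowerSeries.X_pow_dvd_iff.mp (hle hmn) m (by omega)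

theorem eq_zero_of_pow_mul_eq_self {q n : ℕ} (hq : 1 < q) (hqn : n.Coprime q) {u c : R}
    (hu : u ^ q = 1) (hsum : ∑ i ∈ Finset.range q, u ^ i = 0) (hqu : IsUnit (q : R))
    (hc : u ^ n * c = c) : c = 0 := by
  have pow_mul_eq_self {w : R} (hw : w * c = c) (k : ℕ) : w ^ k * c = c := by
    induction k with
    | zero => rw [pow_zero, one_mul]
    | succ k ih => rw [pow_succ, mul_assoc, hw, ih]
  obtain ⟨k, -, hk⟩ := Nat.exists_mul_mod_eq_one_of_coprime hqn hq
  have hunk : (u ^ n) ^ k = u := by rw [← pow_mul, pow_eq_pow_mod _ hu, hk, pow_one]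
  have huc : u * c = c := hunk ▸ pow_mul_eq_self hc k
  refine hqu.mul_right_eq_zero.mp ?_
  calc (q : R) * c = ∑ i ∈ Finset.range q, u ^ i * c := by
        simp only [pow_mul_eq_self huc, Finset.sum_const, Finset.card_range, nsmul_eq_mul]
    _ = 0 := by rw [← Finset.sum_mul, hsum, zero_mul]

theorem coeff_formalAdd_eq_finsum (G : MvPowerSeries (Fin 2) R) {x y : R⟦X⟧} (hx : HasSubst x)
    (hy : HasSubst y) (n : ℕ) :
    coeff n (G.subst ![x, y] : R⟦X⟧) =
      ∑ᶠ d : Fin 2 →₀ ℕ, MvPowerSeries.coeff d G * coeff n (x ^ d 0 * y ^ d 1) := by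
  rw [coeff, MvPowerSeries.coeff_subst (hasSubst_pair hx hy)]
  refine finsum_congr fun d => ?_
  rw [smul_eq_mul, Finsupp.prod_fintype _ _ fun _ => pow_zero _, Fin.prod_univ_two]
  rfl

theorem X_pow_dvd_formalAdd_sub_formalAdd (G : MvPowerSeries (Fin 2) R) {x x' y y' : R⟦X⟧}
    (hx : HasSubst x) (hx' : HasSubst x') (hy : HasSubst y) (hy' : HasSubst y') {n : ℕ}
    (hxx : X ^ n ∣ x - x') (hyy : X ^ n ∣ y - y') :
    X ^ n ∣ (G.subst ![x, y] - G.subst ![x', y'] : R⟦X⟧) := by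
  have hpow (i j : ℕ) : X ^ n ∣ x ^ i * y ^ j - x' ^ i * y' ^ j := by
    rw [show x ^ i * y ^ j - x' ^ i * y' ^ j =
      (x ^ i - x' ^ i) * y ^ j + x' ^ i * (y ^ j - y' ^ j) by ring]
    exact dvd_add ((hxx.trans (sub_dvd_pow_sub_pow _ _ _)).mul_right _)
      ((hyy.trans (sub_dvd_pow_sub_pow _ _ _)).mul_left _)
  refine PowerSeries.X_pow_dvd_iff.mpr fun m hm => ?_
  rw [map_sub, sub_eq_zero, coeff_formalAdd_eq_finsum G hx hy, coeff_formalAdd_eq_finsum G hx' hy']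
  refine finsum_congr fun d => congrArg _ (sub_eq_zero.mp ?_)
  rw [← map_sub]
  exact PowerSeries.X_pow_dvd_iff.mp (hpow _ _) m hm

theorem eq_zero_or_two_le_of_ne_single {d : Fin 2 →₀ ℕ} (h₀ : d ≠ Finsupp.single 0 1)
    (h₁ : d ≠ Finsupp.single 1 1) : d = 0 ∨ 2 ≤ d 0 + d 1 := by
  simp only [ne_eq, Finsupp.ext_iff, Fin.forall_fin_two, Finsupp.single_apply,
    Finsupp.coe_zero, Pi.zero_apply] at h₀ h₁ ⊢
  simp only [↓reduceIte, zero_ne_one, not_and, one_ne_zero] at h₀ h₁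
  omega

theorem coeff_formalAdd_of_X_pow_dvd (F : FormalGroup R) {x y : R⟦X⟧} {n : ℕ} (hn : n ≠ 0)
    (hx : X ^ n ∣ x) (hy : X ^ n ∣ y) :
    coeff n (F.toPowerSeries.subst ![x, y] : R⟦X⟧) = coeff n x + coeff n y := by
  have hasSubst_of_dvd {z : R⟦X⟧} (hz : X ^ n ∣ z) : HasSubst z :=
    HasSubst.of_constantCoeff_zero' (PowerSeries.X_dvd_iff.mp ((dvd_pow_self _ hn).trans hz))
  have hlinear : (fun d : Fin 2 →₀ ℕ => MvPowerSeries.coeff d F.toPowerSeries *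
      coeff n (x ^ d 0 * y ^ d 1)).support ⊆
      (({Finsupp.single 0 1, Finsupp.single 1 1} : Finset (Fin 2 →₀ ℕ)) : Set _) := by
    refine Function.support_subset_iff'.mpr fun d hd => ?_
    simp only [Finset.coe_insert, Finset.coe_singleton, Set.mem_insert_iff,
      Set.mem_singleton_iff, not_or] at hd
    rcases eq_zero_or_two_le_of_ne_single hd.1 hd.2 with rfl | h2
    · rw [MvPowerSeries.coeff_zero_eq_constantCoeff_apply, F.zero_constantCoeff, zero_mul]
    · have h : X ^ (n * (d 0 + d 1)) ∣ x ^ d 0 * y ^ d 1 := by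
        rw [mul_add, pow_add, pow_mul, pow_mul]
        exact mul_dvd_mul (pow_dvd_pow_of_dvd hx _) (pow_dvd_pow_of_dvd hy _)
      rw [PowerSeries.X_pow_dvd_iff.mp h n (by nlinarith [Nat.pos_of_ne_zero hn]), mul_zero]
  rw [coeff_formalAdd_eq_finsum _ (hasSubst_of_dvd hx) (hasSubst_of_dvd hy),
    finsum_eq_sum_of_support_subset _ hlinear,
    Finset.sum_pair (Finsupp.single_left_injective one_ne_zero |>.ne zero_ne_one),
    F.lin_coeff_X, F.lin_coeff_Y]
  simp

namespace Curve

variable {F : FormalGroup R}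

/-- The power series of a curve. -/
def series (x : Curve F) : R⟦X⟧ := x.val

theorem hasSubst (x : Curve F) : HasSubst x.series :=
  x.prop

theorem ext {x y : Curve F} (h : x.series = y.series) : x = y :=
  Subtype.ext h

theorem series_add (x y : Curve F) :
    (x + y).series = F.toPowerSeries.subst ![x.series, y.series] :=
  rfl

variable (F) in
/-- Congruence modulo `t ^ n`, which formal addition respects. -/
def congruence (n : ℕ) : AddCon (Curve F) where
  r x y := X ^ n ∣ x.series - y.series
  iseqv := {
    refl x := by rw [sub_self]; exact dvd_zero _
    symm := dvd_sub_comm.mp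
    trans hxy hyz := by rw [← sub_add_sub_cancel]; exact dvd_add hxy hyz }
  add' {x x' y y'} hx hy := X_pow_dvd_formalAdd_sub_formalAdd F.toPowerSeries x.hasSubst
    x'.hasSubst y.hasSubst y'.hasSubst hx hy

theorem congruence_zero_iff {n : ℕ} {x : Curve F} : congruence F n x 0 ↔ X ^ n ∣ x.series := by
  change X ^ n ∣ x.series - 0 ↔ _
  rw [sub_zero]

variable (F) in
/-- The curves that are congruent to `0` modulo `t ^ n`. -/
def filtration (n : ℕ) : AddSubmonoid (Curve F) where
  carrier := {x | X ^ n ∣ x.series}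
  zero_mem' := dvd_zero _
  add_mem' {x y} hx hy := congruence_zero_iff.mp <| by
    simpa only [add_zero] using
      (congruence F n).add (congruence_zero_iff.mpr hx) (congruence_zero_iff.mpr hy)

theorem coeff_series_add {n : ℕ} (hn : n ≠ 0) {x y : Curve F} (hx : x ∈ filtration F n)
    (hy : y ∈ filtration F n) :
    coeff n (x + y).series = coeff n x.series + coeff n y.series :=
  coeff_formalAdd_of_X_pow_dvd F hn hx hy

theorem coeff_series_sum [F.IsComm] {n : ℕ} (hn : n ≠ 0) {ι : Type*} (s : Finset ι)
    {x : ι → Curve F} (hx : ∀ i, x i ∈ filtration F n) :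
    coeff n (∑ i ∈ s, x i).series = ∑ i ∈ s, coeff n (x i).series := by
  induction s using Finset.cons_induction with
  | empty => exact map_zero (coeff n)
  | cons i s hi ih =>
    rw [Finset.sum_cons, Finset.sum_cons,
      coeff_series_add hn (hx i) (sum_mem fun i _ => hx i), ih]

variable (F) in
/-- The curve `t`. -/
def id : Curve F := ⟨X, HasSubst.X'⟩

variable (F) in
/-- The curve `a t ^ n`. -/
def monomial (a : R) {n : ℕ} (hn : n ≠ 0) : Curve F :=
  ⟨C a * X ^ n, HasSubst.of_constantCoeff_zero' <| by
    rw [map_mul, map_pow, PowerSeries.constantCoeff_X, zero_pow hn, mul_zero]⟩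

theorem monomial_mem_filtration (a : R) {n : ℕ} (hn : n ≠ 0) :
    monomial F a hn ∈ filtration F n :=
  dvd_mul_left _ _

variable (F) in
/-- The additive endomorphism `x(t) ↦ x(ut)`. -/
def homothety (u : R) : Curve F →+ Curve F where
  toFun x := ⟨rescale u x.series, by
    rw [rescale_eq_mvSubst]
    exact MvPowerSeries.IsNilpotent_subst (HasSubst.smul_X' u).const x.hasSubst⟩
  map_zero' := ext (map_zero (rescale u))
  map_add' x y := ext <| by
    change rescale u (x + y).series = F.toPowerSeries.subst ![rescale u x.series,
      rescale u y.series]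
    rw [rescale_eq_mvSubst, rescale_eq_mvSubst, rescale_eq_mvSubst]
    exact subst_pair_subst _ x.hasSubst y.hasSubst (HasSubst.smul_X' u).const

theorem series_homothety (u : R) (x : Curve F) :
    (homothety F u x).series = rescale u x.series :=
  rfl

theorem homothety_homothety (u v : R) (x : Curve F) :
    homothety F u (homothety F v x) = homothety F (v * u) x :=
  ext (PowerSeries.rescale_rescale _ _ _)

theorem homothety_mem_filtration (u : R) {n : ℕ} {x : Curve F} (hx : x ∈ filtration F n) :
    homothety F u x ∈ filtration F n :=
  X_pow_dvd_rescale u hx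

/-- The additive map that a ring homomorphism induces on curves. The equation `F.map f = G` is an
argument so that iterated base changes have a common target. -/
def map {G : FormalGroup S} (f : R →+* S) (hf : F.map f = G) : Curve F →+ Curve G where
  toFun x := ⟨PowerSeries.map f x.series, hasSubst_map f x.hasSubst⟩
  map_zero' := ext (map_zero (PowerSeries.map f))
  map_add' x y := ext <| by
    subst hf
    change MvPowerSeries.map f (F.toPowerSeries.subst ![x.val, y.val]) = _
    rw [MvPowerSeries.map_subst (hasSubst_pair x.prop y.prop), map_pair]
    rfl

theorem series_map {G : FormalGroup S} (f : R →+* S) (hf : F.map f = G) (x : Curve F) :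
    (map f hf x).series = PowerSeries.map f x.series :=
  rfl

theorem map_homothety {G : FormalGroup S} (f : R →+* S) (hf : F.map f = G) (u : R) (x : Curve F) :
    map f hf (homothety F u x) = homothety G (f u) (map f hf x) :=
  ext <| PowerSeries.ext fun n => by
    simp only [series_map, series_homothety, PowerSeries.coeff_map, PowerSeries.coeff_rescale,
      map_mul, map_pow]

theorem formalSum_eq_series_sum {ι : Type*} (l : List ι) (x : ι → Curve F) :
    formalSum F (l.map fun i => (x i).series) = (l.map x).sum.series := by
  induction l with
  | nil => rfl
  | cons i l ih =>
    rw [List.map_cons, List.map_cons, List.sum_cons, series_add, ← ih]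
    rfl

section HomothetySum

variable (F) [F.IsComm]

/-- The additive endomorphism `x(t) ↦ ∑^F_{i < q} x(u ^ i t)`. -/
def homothetySum (q : ℕ) (u : R) : Curve F →+ Curve F :=
  ∑ i ∈ Finset.range q, homothety F (u ^ i)

variable {F}

theorem homothetySum_apply (q : ℕ) (u : R) (x : Curve F) :
    homothetySum F q u x = ∑ i ∈ Finset.range q, homothety F (u ^ i) x :=
  AddMonoidHom.finsetSum_apply _ _ _

theorem homothetySum_comm (q r : ℕ) (u v : R) (x : Curve F) :
    homothetySum F q u (homothetySum F r v x) = homothetySum F r v (homothetySum F q u x) := by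
  simp only [homothetySum_apply, map_sum, homothety_homothety]
  rw [Finset.sum_comm]
  simp only [mul_comm]

theorem map_homothetySum {G : FormalGroup S} [G.IsComm] (f : R →+* S) (hf : F.map f = G) (q : ℕ)
    (u : R) (x : Curve F) :
    map f hf (homothetySum F q u x) = homothetySum G q (f u) (map f hf x) := by
  simp only [homothetySum_apply, map_sum, map_homothety, map_pow]

theorem homothetySum_congr (q : ℕ) (u : R) {n : ℕ} {x y : Curve F} (h : congruence F n x y) :
    congruence F n (homothetySum F q u x) (homothetySum F q u y) := by
  rw [homothetySum_apply, homothetySum_apply]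
  refine AddCon.finsetSum _ _ fun i _ => ?_
  change X ^ n ∣ rescale _ x.series - rescale _ y.series
  rw [← map_sub]
  exact X_pow_dvd_rescale _ h

theorem homothetySum_mem_filtration (q : ℕ) (u : R) {n : ℕ} {x : Curve F}
    (hx : x ∈ filtration F n) : homothetySum F q u x ∈ filtration F n := by
  rw [homothetySum_apply]
  exact sum_mem fun i _ => homothety_mem_filtration _ hx

theorem coeff_homothetySum_of_dvd {q n : ℕ} (hn : n ≠ 0) {u : R} (hu : u ^ q = 1) (hqn : q ∣ n)
    {x : Curve F} (hx : x ∈ filtration F n) :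
    coeff n (homothetySum F q u x).series = q * coeff n x.series := by
  have hun : u ^ n = 1 := by
    obtain ⟨k, rfl⟩ := hqn
    rw [pow_mul, hu, one_pow]
  rw [homothetySum_apply, coeff_series_sum hn _ fun i => homothety_mem_filtration _ hx]
  simp only [series_homothety, PowerSeries.coeff_rescale, pow_right_comm u, hun, one_pow, one_mul,
    Finset.sum_const, Finset.card_range, nsmul_eq_mul]

theorem coeff_homothetySum_compatible {q r n : ℕ} (hn : n ≠ 0) {u v : R} (hu : u ^ q = 1)
    (hv : v ^ r = 1) (hqn : q ∣ n) (hrn : r ∣ n) {x : Curve F}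
    (hxu : homothetySum F q u x ∈ filtration F n) (hxv : homothetySum F r v x ∈ filtration F n) :
    r * coeff n (homothetySum F q u x).series = q * coeff n (homothetySum F r v x).series := by
  rw [← coeff_homothetySum_of_dvd hn hv hrn hxu, homothetySum_comm,
    coeff_homothetySum_of_dvd hn hu hqn hxv]

theorem homothety_homothetySum (q : ℕ) {u : R} (hu : u ^ q = 1) (x : Curve F) :
    homothety F u (homothetySum F q u x) = homothetySum F q u x := by
  cases q with
  | zero => simp only [homothetySum_apply, Finset.sum_range_zero, map_zero]
  | succ q =>
    simp only [homothetySum_apply, map_sum, homothety_homothety, ← pow_succ]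
    rw [Finset.sum_range_succ, Finset.sum_range_succ' (fun i => homothety F (u ^ i) x), hu,
      pow_zero]

theorem coeff_homothetySum_of_coprime {q n : ℕ} (hq : 1 < q) (hqn : n.Coprime q) {u : R}
    (hu : u ^ q = 1) (hsum : ∑ i ∈ Finset.range q, u ^ i = 0) (hqu : IsUnit (q : R))
    (x : Curve F) : coeff n (homothetySum F q u x).series = 0 := by
  refine eq_zero_of_pow_mul_eq_self hq hqn hu hsum hqu ?_
  rw [← PowerSeries.coeff_rescale, ← series_homothety, homothety_homothetySum q hu]

theorem formalSum_eq_series_homothetySum (q : ℕ) (u : R) :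
    formalSum F ((List.range q).map fun i => C (u ^ i) * X) =
      (homothetySum F q u (id F)).series := by
  have h (i : ℕ) : C (u ^ i) * X = (homothety F (u ^ i) (id F)).series :=
    (PowerSeries.rescale_X _).symm
  simp only [h]
  rw [formalSum_eq_series_sum, homothetySum_apply]
  rfl

end HomothetySum

end Curve

namespace IsStrictIso

variable {γ : R⟦X⟧} {F₁ F₂ : FormalGroup R}

/-- The additive map `x ↦ γ(x)` on curves that a strict isomorphism `γ` induces. -/
def curveHom (h : IsStrictIso γ F₁ F₂) : Curve F₂ →+ Curve F₁ where
  toFun x := ⟨γ.subst x.series, hasSubst_subst h.constantCoeff_eq x.hasSubst⟩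
  map_zero' := Curve.ext (subst_zero_eq h.constantCoeff_eq)
  map_add' x y := Curve.ext (h.subst_formalAdd x.hasSubst y.hasSubst)

theorem series_curveHom (h : IsStrictIso γ F₁ F₂) (x : Curve F₂) :
    (h.curveHom x).series = γ.subst x.series :=
  rfl

theorem curveHom_injective (h : IsStrictIso γ F₁ F₂) : Function.Injective h.curveHom :=
  fun x y hxy => Curve.ext <| by
    rw [← substInv_subst_subst h.constantCoeff_eq h.isUnit_coeff_one x.hasSubst,
      ← series_curveHom h, hxy, series_curveHom,
      substInv_subst_subst h.constantCoeff_eq h.isUnit_coeff_one y.hasSubst]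

theorem curveHom_homothety (h : IsStrictIso γ F₁ F₂) (u : R) (x : Curve F₂) :
    h.curveHom (Curve.homothety F₂ u x) = Curve.homothety F₁ u (h.curveHom x) :=
  Curve.ext <| by
    rw [series_curveHom, Curve.series_homothety, Curve.series_homothety, series_curveHom,
      rescale_eq_mvSubst, rescale_eq_mvSubst]
    exact (mvSubst_subst γ x.hasSubst (HasSubst.smul_X' u).const).symm

theorem curveHom_homothetySum [F₁.IsComm] [F₂.IsComm] (h : IsStrictIso γ F₁ F₂) (q : ℕ) (u : R)
    (x : Curve F₂) :
    h.curveHom (Curve.homothetySum F₂ q u x) = Curve.homothetySum F₁ q u (h.curveHom x) := by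
  simp only [Curve.homothetySum_apply, map_sum, h.curveHom_homothety]

end IsStrictIso

end Curves

section PTypification

open Polynomial (cyclotomic)

/-- The ring `A[ζ_q] = A[z]/(Φ_q(z))`. -/
abbrev CyclotomicExt (q : ℕ) (A : Type*) [CommRing A] : Type _ := AdjoinRoot (cyclotomic q A)

/-- The class `ζ_q` of `z` in `A[z]/(Φ_q(z))`. -/
def zeta (q : ℕ) (A : Type*) [CommRing A] : CyclotomicExt q A := AdjoinRoot.root (cyclotomic q A)

/-- The inclusion of `A` into `A[ζ_q]`. -/
def cyclotomicOf (q : ℕ) (A : Type*) [CommRing A] : A →+* CyclotomicExt q A :=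
  AdjoinRoot.of (cyclotomic q A)

/-- The coordinate at `1` with respect to the basis `1, ζ, …, ζ^{φ(q)-1}` of `A[ζ_q]`. -/
def constCoord (q : ℕ) (A : Type*) [CommRing A] : CyclotomicExt q A →ₗ[A] A :=
  Polynomial.lcoeff A 0 ∘ₗ AdjoinRoot.modByMonicHom (Polynomial.cyclotomic.monic q A)

variable {A B D : Type*} [CommRing A] [CommRing B] [CommRing D]

theorem zeta_pow_eq_one (q : ℕ) (A : Type*) [CommRing A] : zeta q A ^ q = 1 := by
  obtain ⟨P, hP⟩ := Polynomial.cyclotomic.dvd_X_pow_sub_one q A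
  have h := congrArg (AdjoinRoot.mk (cyclotomic q A)) hP
  rw [map_mul, AdjoinRoot.mk_self, zero_mul, map_sub, map_pow, AdjoinRoot.mk_X, map_one] at h
  exact sub_eq_zero.mp h

theorem sum_zeta_pow {q : ℕ} (hq : q.Prime) (A : Type*) [CommRing A] :
    ∑ i ∈ Finset.range q, zeta q A ^ i = 0 := by
  have := Fact.mk hq
  have h := congrArg (AdjoinRoot.mk (cyclotomic q A)) (Polynomial.cyclotomic_prime A q)
  simp only [AdjoinRoot.mk_self, map_sum, map_pow, AdjoinRoot.mk_X] at h
  exact h.symm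

theorem constCoord_cyclotomicOf {q : ℕ} (hq : 0 < q) (a : A) :
    constCoord q A (cyclotomicOf q A a) = a := by
  nontriviality A
  have hdeg : (Polynomial.C a).degree < (cyclotomic q A).degree := by
    refine Polynomial.degree_C_le.trans_lt ?_
    rw [Polynomial.degree_cyclotomic]
    exact_mod_cast Nat.totient_pos.mpr hq
  rw [cyclotomicOf, ← AdjoinRoot.mk_C, constCoord, LinearMap.comp_apply,
    AdjoinRoot.modByMonicHom_mk,
    (Polynomial.modByMonic_eq_self_iff (Polynomial.cyclotomic.monic q A)).mpr hdeg,
    Polynomial.lcoeff_apply, Polynomial.coeff_C_zero]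

theorem constCoord_cyclotomicMap (f : A →+* B) (q : ℕ) (x : CyclotomicExt q A) :
    constCoord q B (cyclotomicMap f q x) = f (constCoord q A x) := by
  rw [constCoord, LinearMap.comp_apply, modByMonicHom_cyclotomicMap, Polynomial.lcoeff_apply,
    Polynomial.coeff_map]
  rfl

theorem cyclotomicMap_zeta (f : A →+* B) (q : ℕ) : cyclotomicMap f q (zeta q A) = zeta q B := by
  simp [cyclotomicMap, zeta]

theorem cyclotomicMap_comp_cyclotomicOf (f : A →+* B) (q : ℕ) :
    (cyclotomicMap f q).comp (cyclotomicOf q A) = (cyclotomicOf q B).comp f :=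
  RingHom.ext fun a => by simp [cyclotomicMap, cyclotomicOf]

variable (F : FormalGroup A) [F.IsComm]

/-- The map `x(t) ↦ ∑^F_{i < q} x(u ^ i t)` to the curves over a ring `B` that contains `u`. -/
def homothetySumOver (q : ℕ) (f : A →+* B) (u : B) : Curve F →+ Curve (F.map f) :=
  (Curve.homothetySum (F.map f) q u).comp (Curve.map f rfl)

/-- The map `x(t) ↦ ∑^F_{i < q} x(ζ ^ i t)` for a `q`-th root of unity `ζ`. -/
def cyclotomicSum (q : ℕ) : Curve F →+ Curve (F.map (cyclotomicOf q A)) :=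
  homothetySumOver F q (cyclotomicOf q A) (zeta q A)

variable {F}

theorem map_series_homothetySumOver (q : ℕ) (f : A →+* B) (u : B) (g : B →+* D) (x : Curve F) :
    PowerSeries.map g (homothetySumOver F q f u x).series =
      (homothetySumOver F q (g.comp f) (g u) x).series := by
  have h := Curve.map_homothetySum g (formalGroup_map_map F f g) q u (Curve.map f rfl x)
  have hx : Curve.map g (formalGroup_map_map F f g) (Curve.map f rfl x) =
      Curve.map (g.comp f) rfl x :=
    Curve.ext (by rw [Curve.series_map, Curve.series_map, Curve.series_map, PowerSeries.map_comp,
      RingHom.comp_apply])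
  rw [hx] at h
  exact congrArg Curve.series h

theorem cyclotomicSum_congr (q : ℕ) {n : ℕ} {x y : Curve F} (h : Curve.congruence F n x y) :
    Curve.congruence _ n (cyclotomicSum F q x) (cyclotomicSum F q y) := by
  refine Curve.homothetySum_congr q _ ?_
  change X ^ n ∣ PowerSeries.map _ x.series - PowerSeries.map _ y.series
  rw [← map_sub]
  exact X_pow_dvd_map _ h

theorem cyclotomicSum_mem_filtration (q : ℕ) {n : ℕ} {x : Curve F}
    (hx : x ∈ Curve.filtration F n) : cyclotomicSum F q x ∈ Curve.filtration _ n :=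
  Curve.homothetySum_mem_filtration q _ (X_pow_dvd_map _ hx)

theorem coeff_cyclotomicSum_compatible {q r n : ℕ} (hn : n ≠ 0) (hr : 0 < r) (hqn : q ∣ n)
    (hrn : r ∣ n) {x : Curve F} (hxq : cyclotomicSum F q x ∈ Curve.filtration _ n)
    (hxr : cyclotomicSum F r x ∈ Curve.filtration _ n) :
    r * coeff n (cyclotomicSum F q x).series =
      q * cyclotomicOf q A (constCoord r A (coeff n (cyclotomicSum F r x).series)) := by
  -- Both sums are curves over `A[ζ_q][ζ_r]`; the coordinate at `1` eliminates `ζ_r` again.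
  let ι := cyclotomicOf q A
  let κ := cyclotomicOf r (CyclotomicExt q A)
  let x' := Curve.map (κ.comp ι) rfl x
  have hq : PowerSeries.map κ (cyclotomicSum F q x).series =
      (Curve.homothetySum _ q (κ (zeta q A)) x').series :=
    map_series_homothetySumOver q ι (zeta q A) κ x
  have hr' : PowerSeries.map (cyclotomicMap ι r) (cyclotomicSum F r x).series =
      (Curve.homothetySum _ r (zeta r (CyclotomicExt q A)) x').series := by
    have h := map_series_homothetySumOver r (cyclotomicOf r A) (zeta r A) (cyclotomicMap ι r) x
    rwa [cyclotomicMap_comp_cyclotomicOf, cyclotomicMap_zeta] at h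
  have key := Curve.coeff_homothetySum_compatible (x := x') hn
    (by rw [← map_pow, zeta_pow_eq_one, map_one]) (zeta_pow_eq_one r _) hqn hrn
    ((X_pow_dvd_map κ hxq).trans (dvd_of_eq hq))
    ((X_pow_dvd_map (cyclotomicMap ι r) hxr).trans (dvd_of_eq hr'))
  rw [← hq, ← hr', PowerSeries.coeff_map, PowerSeries.coeff_map] at key
  have key' := congrArg (constCoord r (CyclotomicExt q A)) key
  simp only [← nsmul_eq_mul, map_nsmul] at key' ⊢
  rwa [constCoord_cyclotomicOf hr, constCoord_cyclotomicMap] at key'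

theorem coeff_cyclotomicSum_of_coprime {q n : ℕ} (hq : q.Prime) (hqA : IsUnit (q : A))
    (hqn : ¬ q ∣ n) (x : Curve F) : coeff n (cyclotomicSum F q x).series = 0 := by
  refine Curve.coeff_homothetySum_of_coprime hq.one_lt
    ((Nat.Prime.coprime_iff_not_dvd hq).mpr hqn).symm (zeta_pow_eq_one q A) (sum_zeta_pow hq A) ?_ _
  rw [← map_natCast (cyclotomicOf q A)]
  exact hqA.map _

theorem coeff_cyclotomicSum_monomial (a : A) {q n : ℕ} (hn : n ≠ 0) (hqn : q ∣ n) :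
    coeff n (cyclotomicSum F q (Curve.monomial F a hn)).series = q * cyclotomicOf q A a := by
  refine (Curve.coeff_homothetySum_of_dvd hn (zeta_pow_eq_one q A) hqn
    (X_pow_dvd_map _ (Curve.monomial_mem_filtration a hn))).trans ?_
  rw [Curve.series_map, PowerSeries.coeff_map]
  exact congrArg _ (congrArg _ ((PowerSeries.coeff_C_mul_X_pow a n n).trans (if_pos rfl)))

/-- A curve is `p`-typical if the sums over the `q`-th roots of unity vanish for all primes
`q ≠ p`. -/
def IsPTypicalCurve (p : ℕ) (x : Curve F) : Prop :=
  ∀ q : ℕ, q.Prime → q ≠ p → cyclotomicSum F q x = 0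

/-- Being `p`-typical modulo `t ^ n`. -/
def IsPTypicalCurveMod (p n : ℕ) (x : Curve F) : Prop :=
  ∀ q : ℕ, q.Prime → q ≠ p → cyclotomicSum F q x ∈ Curve.filtration _ n

theorem isPTypical_iff_isPTypicalCurve_id {p : ℕ} :
    IsPTypical p F ↔ IsPTypicalCurve p (Curve.id F) := by
  have h (q : ℕ) : rootSum F q = (cyclotomicSum F q (Curve.id F)).series := by
    have hid : Curve.map (cyclotomicOf q A) rfl (Curve.id F) = Curve.id _ :=
      Curve.ext (PowerSeries.map_X _)
    rw [cyclotomicSum, homothetySumOver, AddMonoidHom.comp_apply, hid]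
    exact Curve.formalSum_eq_series_homothetySum q (zeta q A)
  simp only [IsPTypical, IsPTypicalCurve, h]
  exact forall₃_congr fun q _ _ => ⟨fun hq => Curve.ext hq, congrArg Curve.series⟩

theorem IsStrictIso.isPTypicalCurve_curveHom_iff {p : ℕ} {γ : A⟦X⟧} {F₁ F₂ : FormalGroup A}
    [F₁.IsComm] [F₂.IsComm] (h : IsStrictIso γ F₁ F₂) {x : Curve F₂} :
    IsPTypicalCurve p (h.curveHom x) ↔ IsPTypicalCurve p x := by
  have key (q : ℕ) : cyclotomicSum F₁ q (h.curveHom x) =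
      (h.map (cyclotomicOf q A)).curveHom (cyclotomicSum F₂ q x) := by
    have hmap : Curve.map (cyclotomicOf q A) rfl (h.curveHom x) =
        (h.map (cyclotomicOf q A)).curveHom (Curve.map _ rfl x) :=
      Curve.ext (PowerSeries.map_subst x.hasSubst γ)
    rw [cyclotomicSum, homothetySumOver, AddMonoidHom.comp_apply, hmap,
      ← IsStrictIso.curveHom_homothetySum]
    rfl
  exact forall₃_congr fun q _ _ => by
    rw [key, map_eq_zero_iff _ (h.map (cyclotomicOf q A)).curveHom_injective]

section

variable {p : ℕ} (hA : ∀ q : ℕ, q.Prime → q ≠ p → IsUnit (q : A))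

include hA

theorem isPTypicalCurveMod_two_id : IsPTypicalCurveMod p 2 (Curve.id F) := fun q hq hqp =>
  X_pow_succ_dvd_iff.mpr ⟨cyclotomicSum_mem_filtration q (dvd_of_eq (pow_one X)),
    coeff_cyclotomicSum_of_coprime hq (hA q hq hqp) (mt Nat.dvd_one.mp hq.ne_one) _⟩

theorem isPTypicalCurveMod_add_monomial {n : ℕ} (hn : n ≠ 0) {x : Curve F}
    (hx : IsPTypicalCurveMod p n x) {a : A}
    (ha : ∀ q : ℕ, q.Prime → q ≠ p → q ∣ n →
      coeff n (cyclotomicSum F q x).series + q * cyclotomicOf q A a = 0) :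
    IsPTypicalCurveMod p (n + 1) (x + Curve.monomial F a hn) := by
  intro q hq hqp
  have hm := cyclotomicSum_mem_filtration q (Curve.monomial_mem_filtration (F := F) a hn)
  refine X_pow_succ_dvd_iff.mpr ⟨?_, ?_⟩
  · rw [map_add]
    exact add_mem (hx q hq hqp) hm
  · by_cases hqn : q ∣ n
    · rw [map_add, Curve.coeff_series_add hn (hx q hq hqp) hm,
        coeff_cyclotomicSum_monomial a hn hqn, ha q hq hqp hqn]
    · exact coeff_cyclotomicSum_of_coprime hq (hA q hq hqp) hqn _

theorem exists_coeff_cyclotomicSum_add_eq_zero {n : ℕ} (hn : n ≠ 0) {x : Curve F}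
    (hx : IsPTypicalCurveMod p n x) :
    ∃ a : A, ∀ q : ℕ, q.Prime → q ≠ p → q ∣ n →
      coeff n (cyclotomicSum F q x).series + q * cyclotomicOf q A a = 0 := by
  by_cases hr : ∃ r : ℕ, r.Prime ∧ r ≠ p ∧ r ∣ n
  · obtain ⟨r, hr, hrp, hrn⟩ := hr
    obtain ⟨c, hc⟩ := (hA r hr hrp).dvd (a := constCoord r A (coeff n (cyclotomicSum F r x).series))
    refine ⟨-c, fun q hq hqp hqn => ?_⟩
    have key := coeff_cyclotomicSum_compatible hn hr.pos hqn hrn (hx q hq hqp) (hx r hr hrp)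
    have hu : IsUnit (r : CyclotomicExt q A) := by
      rw [← map_natCast (cyclotomicOf q A)]
      exact (hA r hr hrp).map _
    refine hu.mul_right_eq_zero.mp ?_
    rw [mul_add, key, hc, map_mul, map_neg, map_natCast]
    ring
  · exact ⟨0, fun q hq hqp hqn => absurd ⟨q, hq, hqp, hqn⟩ hr⟩

theorem exists_congruence_isPTypicalCurveMod_succ {n : ℕ} (hn : n ≠ 0) {x : Curve F}
    (hx : IsPTypicalCurveMod p n x) :
    ∃ y : Curve F, Curve.congruence F n y x ∧ IsPTypicalCurveMod p (n + 1) y := by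
  obtain ⟨a, ha⟩ := exists_coeff_cyclotomicSum_add_eq_zero hA hn hx
  refine ⟨x + Curve.monomial F a hn, ?_, isPTypicalCurveMod_add_monomial hA hn hx ha⟩
  simpa only [add_zero] using (Curve.congruence F n).add ((Curve.congruence F n).refl x)
    (Curve.congruence_zero_iff.mpr (Curve.monomial_mem_filtration a hn))

variable (F) in
theorem exists_isPTypicalCurve : ∃ x : Curve F,
    constantCoeff x.series = 0 ∧ coeff 1 x.series = 1 ∧ IsPTypicalCurve p x := by
  choose! next hnext using fun (n : ℕ) (x : Curve F) =>
    exists_congruence_isPTypicalCurveMod_succ hA (Nat.succ_ne_zero (n + 1)) (x := x)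
  let x (n : ℕ) : Curve F := n.rec (Curve.id F) next
  have hx (n : ℕ) : IsPTypicalCurveMod p (n + 2) (x n) := by
    induction n with
    | zero => exact isPTypicalCurveMod_two_id hA
    | succ n ih => exact (hnext n (x n) ih).2
  obtain ⟨γ, hγ⟩ := exists_forall_X_pow_dvd_sub (x := fun n => (x n).series) (k := 2)
    fun n => (hnext n (x n) (hx n)).1
  have hlow {m : ℕ} (hm : m < 2) : coeff m γ = coeff m (X : A⟦X⟧) := by
    rw [← sub_eq_zero, ← map_sub]
    exact PowerSeries.X_pow_dvd_iff.mp (hγ 0) m hm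
  have hγ₀ : constantCoeff γ = 0 := by
    rw [← PowerSeries.coeff_zero_eq_constantCoeff_apply, hlow two_pos, PowerSeries.coeff_zero_X]
  let y : Curve F := ⟨γ, HasSubst.of_constantCoeff_zero' hγ₀⟩
  refine ⟨y, hγ₀, (hlow one_lt_two).trans PowerSeries.coeff_one_X, fun q hq hqp =>
    Curve.ext (PowerSeries.ext fun n => ?_)⟩
  have hn : Curve.congruence _ (n + 2) (cyclotomicSum F q y) 0 :=
    (Curve.congruence _ _).trans (cyclotomicSum_congr q (hγ n))
      (Curve.congruence_zero_iff.mpr (hx n q hq hqp))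
  exact PowerSeries.X_pow_dvd_iff.mp (Curve.congruence_zero_iff.mp hn) n (by omega)

variable (F) in
theorem exists_isPTypical_strictlyIsomorphic :
    ∃ F' : FormalGroup A, F'.IsComm ∧ IsPTypical p F' ∧ StrictlyIsomorphic F F' := by
  obtain ⟨x, hx₀, hx₁, hx⟩ := exists_isPTypicalCurve F hA
  obtain ⟨F', hF', h⟩ := exists_isComm_isStrictIso F hx₀ hx₁
  have hid : h.curveHom (Curve.id F') = x := Curve.ext (PowerSeries.X_subst x.series)
  exact ⟨F', hF', isPTypical_iff_isPTypicalCurve_id.mpr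
    (h.isPTypicalCurve_curveHom_iff.mp (by rwa [hid])), x.series, h⟩

end

theorem isUnit_intCast_lazardLoc (p : ℕ) [Fact p.Prime] {n : ℤ} (hn : ¬ (p : ℤ) ∣ n) :
    IsUnit (n : LazardLoc p) := by
  have h := IsLocalization.map_units (LazardLoc p)
    (⟨Int.castRingHom Lazard n, n, hn, rfl⟩ : (primeTo p).map (Int.castRingHom Lazard))
  simpa only [eq_intCast, map_intCast] using h

instance (p : ℕ) [Fact p.Prime] : (universalLoc p).IsComm :=
  isComm_map universalFGL _

theorem exists_strictlyIsomorphic_universalPTypical (p : ℕ) [hp : Fact p.Prime] :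
    ∃ g : BP p →+* LazardLoc p,
      StrictlyIsomorphic (universalLoc p) ((universalPTypical p).map g) := by
  have hprime (q : ℕ) (hq : q.Prime) (hqp : q ≠ p) : IsUnit (q : LazardLoc p) := by
    have hpq : ¬ (p : ℤ) ∣ q := fun h =>
      hqp ((Nat.prime_dvd_prime_iff_eq hp.out hq).mp (Int.natCast_dvd_natCast.mp h)).symm
    simpa only [Int.cast_natCast] using isUnit_intCast_lazardLoc p hpq
  obtain ⟨F', hF', hpt, hiso⟩ := exists_isPTypical_strictlyIsomorphic (universalLoc p) hprime
  obtain ⟨g, hg, -⟩ :=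
    existsUnique_universalPTypical p (fun _ => isUnit_intCast_lazardLoc p) F' hpt
  exact ⟨g, hg ▸ hiso⟩

end PTypification

end LazardBP

end

theorem mainTheorem10 (p : ℕ) [Fact p.Prime]
    (M : Type*) [AddCommGroup M] [Module Lazard M] (C : Comodule M) :
    (∃ g : BP p →+* LazardLoc p,
      StrictlyIsomorphic (universalLoc p) ((universalPTypical p).map g)) ∧
    (∀ g : BP p →+* LazardLoc p,
      StrictlyIsomorphic (universalLoc p) ((universalPTypical p).map g) →
      Nonempty ((LazardLoc p ⊗[Lazard] M) ≃ₗ[LazardLoc p]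
        (Via g ⊗[BP p] (BP p ⊗[Lazard] M)))) ∧
    (∀ (A : Type*) [CommRing A] (f₁ f₂ : Lazard →+* A) (γ : PowerSeries A),
      IsStrictIso γ (universalFGL.map f₁) (universalFGL.map f₂) →
      ∃! h : (Via f₁ ⊗[Lazard] M) ≃ₗ[A] (Via f₂ ⊗[Lazard] M),
        ∀ m : M, h (1 ⊗ₜ[Lazard] m) =
          (evalLB f₂ γ).toLinearMap.rTensor M (C.coaction m)) := by
  exact ⟨exists_strictlyIsomorphic_universalPTypical p,
    fun g h => nonempty_baseChange_equiv_of_strictlyIsomorphic C g h,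
    fun _ _ _ _ _ h => existsUnique_comparisonEquiv C h⟩
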